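/- Let $X_1,X_2,\dots$ be independent real random variables with a common continuous distribution (i.e. $\mathbb P(X_1=x)=0$ for every $x\in\mathbb R$), and let $S_0=0$, $S_j=X_1+\cdots+X_j$. Let $q\in[0,1)$ and let $n(q)$ be a random variable with values in $\{0,1,2,\dots\}$, independent of $(X_i)_{i\ge1}$, with the geometric distribution with parameter $1-q$, i.e. $\mathbb P(n(q)\ge n)=q^n$ for $n=0,1,2,\dots$ (with $0^0=1$). Let $M_{n(q)}=\max_{0\le k\le n(q)}S_k$, and let $L_{n(q)}$ be the (first) time $k\in\{0,\dots,n(q)\}$ with $S_k=M_{n(q)}$. The concave majorant of the walk up to time $n(q)$ is the least concave function $C$ on $[0,n(q)]$ with $C(j)\ge S_j$ for $0\le j\le n(q)$; its faces are the chords between successive times $a<b$ in $\{0,\dots,n(q)\}$ at which the walk meets $C$, and such a face has length $b-a$ and increment $S_b-S_a$ (there are no faces if $n(q)=0$). A distribution on $\mathbb R^2$ is called compound Poisson with jump intensity $\nu$, where $\nu$ is a finite measure on $\mathbb R^2$, if $\nu=r\rho$ with $r\ge0$ and $\rho$ a probability measure, and it is the law of $Y_1+\cdots+Y_K$, where $K$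 is Poisson with mean $r$ and, given $K=k$, the variables $Y_1,\dots,Y_k$ are independent with law $\rho$. **Theorem.** The time in $\{0,\dots,n(q)\}$ at which the maximum is attained is almost surely unique (and so equal to $L_{n(q)}$), and the following hold. 1. The pairs $(L_{n(q)},M_{n(q)})$ and $(n(q)-L_{n(q)},\,S_{n(q)}-M_{n(q)})$ are independent. 2. Both pairs have compound Poisson distributions. The jump intensity is the measure on $\{1,2,\dots\}\times\mathbb R$ given by $j^{-1}q^j\,\mathbb P(S_j\in dx)$, $j\ge 1$, restricted to $\{x>0\}$ for the first pair and to $\{x\le0\}$ for the second. 3. Almost surely, $(L_{n(q)},M_{n(q)})$ is the sum of the pairs (length, increment) over all faces of the concave majorant of the walk up to time $n(q)$ whose increment is $>0$, and $(n(q)-L_{n(q)},\,S_{n(q)}-M_{n(q)})$ is the sum of these pairs over all the other faces. -/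

import Mathlib

open MeasureTheory ProbabilityTheory
open scoped NNReal ENNReal

noncomputable section

namespace RandomWalk

/-- The walk with increments `x 0, x 1, …`: `walk x n` is the sum of the first `n` increments. -/
def walk (x : ℕ → ℝ) (n : ℕ) : ℝ := ∑ i ∈ Finset.range n, x i

/-- The maximum of the path `s 0, …, s n`. -/
def pathMax (s : ℕ → ℝ) (n : ℕ) : ℝ :=
  (Finset.range (n + 1)).sup' Finset.nonempty_range_add_one s

/-- The (first) time in `{0, …, n}` at which the path `s 0, …, s n` attains its maximum. -/
def argMax (s : ℕ → ℝ) (n : ℕ) : ℕ := sInf {k : ℕ | k ≤ n ∧ s k = pathMax s n}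

/-- The concave majorant of `(0, s 0), …, (n, s n)`: on `[0, n]` it is the pointwise infimum of all
concave functions on `[0, n]` that dominate the path, which is the least such function. -/
def concaveMajorant (s : ℕ → ℝ) (n : ℕ) (t : ℝ) : ℝ :=
  sInf {y : ℝ | ∃ C : ℝ → ℝ, ConcaveOn ℝ (Set.Icc 0 (n : ℝ)) C ∧
    (∀ j : ℕ, j ≤ n → s j ≤ C j) ∧ C t = y}

/-- `k` is a time in `{0, …, n}` at which the path meets its concave majorant. -/
def IsContact (s : ℕ → ℝ) (n k : ℕ) : Prop := k ≤ n ∧ s k = concaveMajorant s n k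

open Classical in
/-- The faces of the concave majorant of `(0, s 0), …, (n, s n)`, each represented by the pair
`(a, b)` of its left and right end times; these are the pairs of successive contact times. -/
def faces (s : ℕ → ℝ) (n : ℕ) : Finset (ℕ × ℕ) :=
  (Finset.range (n + 1) ×ˢ Finset.range (n + 1)).filter fun f =>
    IsContact s n f.1 ∧ IsContact s n f.2 ∧ f.1 < f.2 ∧
      ∀ k : ℕ, f.1 < k → k < f.2 → ¬ IsContact s n k

/-- The length of a face. -/
def faceLength (f : ℕ × ℕ) : ℝ := (f.2 : ℝ) - (f.1 : ℝ)

/-- The increment of the path over a face. -/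
def faceIncrement (s : ℕ → ℝ) (f : ℕ × ℕ) : ℝ := s f.2 - s f.1

/-- The compound Poisson distribution with rate `r` and jump distribution `ρ`: the law of
`Y 1 + ⋯ + Y K`, where `K` is Poisson with mean `r` and, given `K = k`, the variables
`Y 1, …, Y k` are independent with common law `ρ`. -/
def compoundPoisson {E : Type*} [AddCommMonoid E] [MeasurableSpace E]
    (r : ℝ≥0) (ρ : Measure E) : Measure E :=
  (poissonMeasure r).bind fun k : ℕ =>
    (Measure.pi fun _ : Fin k => ρ).map fun y => ∑ i, y i

/-- `P` is a compound Poisson distribution whose jump intensity measure (rate times jump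
distribution) is `ν`. -/
def IsCompoundPoisson {E : Type*} [AddCommMonoid E] [MeasurableSpace E]
    (P ν : Measure E) : Prop :=
  ∃ (r : ℝ≥0) (ρ : Measure E), IsProbabilityMeasure ρ ∧ ν = (r : ℝ≥0∞) • ρ ∧
    P = compoundPoisson r ρ

/-- The measure on `ℝ × ℝ` that is carried by `{1, 2, …} × A` and is given there by
`j⁻¹ q ^ j P (S_j ∈ dx)`, where `S` is the walk with increments `X 0, X 1, …`. -/
def faceIntensity {Ω : Type*} [MeasurableSpace Ω] (P : Measure Ω) (X : ℕ → Ω → ℝ) (q : ℝ)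
    (A : Set ℝ) : Measure (ℝ × ℝ) :=
  Measure.sum fun i : ℕ =>
    ENNReal.ofReal (q ^ (i + 1) / ((i : ℝ) + 1)) •
      ((P.map fun ω => walk (fun l => X l ω) (i + 1)).restrict A).map
        fun x : ℝ => ((i : ℝ) + 1, x)

end RandomWalk

end

namespace RandomWalk

/-! ### The maximum of a path and the faces of its concave majorant -/

section Path

variable {s : ℕ → ℝ} {n : ℕ}

/-! The statement about faces is deterministic. A unique maximum time is a contact time of the
concave majorant, so no face straddles it. Concavity makes faces to its left rise and faces to its
right fall (`faceIncrement_pos_iff`), and lengths and increments telescope over faces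
(`sum_faces_le`). Uniqueness holds almost surely because an atomless step law makes the walk take
distinct values at distinct times (`ae_walk_injective`).

For the laws, the first maximum up to time `k + m` is at `k` exactly when `k` is a strict record and
the walk restarted at `k` stays nonpositive for `m` steps (`mem_maxAt_add`). These events use
disjoint blocks of increments. Since `P(N = k + m) = (1 - q) q ^ k q ^ m`, the joint law of the two
pairs is a constant times a product of two measures (`measure_pre_inter_post`), which gives
independence.

The compound Poisson property comes from a Wiener–Hopf argument. With `φ` the characteristic
function of a step, `1 / (1 - z φ)` is the product of the generating functions of the record laws
and of the laws of the walk while nonpositive. It is also `exp (∑ z ^ j φ ^ j / j)`, which splits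
into two exponentials according to the sign of `S_j`. Both factorisations are carried by the same
half-lines, and such a factorisation is unique (`eq_of_sum_charFun_mul_eq`), so the factors agree
(`ladderLaw_eq_expSeq`). The exponentials are handled through the recursion given by their
logarithmic derivative. Evaluation at `z = q e^{iθ}` gives a characteristic function proportional to
the exponential of that of the jump intensity (`charFunDual_layers_eq_exp`). Total mass one fixes
the constant. -/

lemma le_pathMax {j : ℕ} (hj : j ≤ n) : s j ≤ pathMax s n :=
  Finset.le_sup' s (Finset.mem_range_succ_iff.2 hj)

lemma argMax_spec (s : ℕ → ℝ) (n : ℕ) : argMax s n ≤ n ∧ s (argMax s n) = pathMax s n := by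
  refine Nat.sInf_mem (s := {k : ℕ | k ≤ n ∧ s k = pathMax s n}) ?_
  obtain ⟨k, hk, h⟩ := Finset.exists_mem_eq_sup' (Finset.nonempty_range_add_one (n := n)) s
  exact ⟨k, Finset.mem_range_succ_iff.1 hk, h.symm⟩

/-- Choosing the first maximum makes the comparison strict before `k` and weak after it. This
asymmetry later separates strict records from nonpositive excursions. -/
lemma argMax_eq_iff {k : ℕ} :
    argMax s n = k ↔ k ≤ n ∧ (∀ j < k, s j < s k) ∧ ∀ j ≤ n, s j ≤ s k := by
  obtain ⟨h1, h2⟩ := argMax_spec s n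
  constructor
  · rintro rfl
    refine ⟨h1, fun j hj => ?_, fun j hj => h2 ▸ le_pathMax hj⟩
    refine lt_of_le_of_ne (h2 ▸ le_pathMax (by omega)) fun h => ?_
    exact Nat.notMem_of_lt_sInf hj ⟨by omega, h.trans h2⟩
  · rintro ⟨hk, hlt, hle⟩
    have hmax : s k = pathMax s n := le_antisymm (le_pathMax hk) (h2 ▸ hle _ h1)
    refine le_antisymm (Nat.sInf_le ⟨hk, hmax⟩) (not_lt.1 fun h => ?_)
    have := hlt _ h
    linarith

lemma le_concaveMajorant_of_forall {t v : ℝ}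
    (h : ∀ C : ℝ → ℝ, ConcaveOn ℝ (Set.Icc 0 (n : ℝ)) C → (∀ j : ℕ, j ≤ n → s j ≤ C j) → v ≤ C t) :
    v ≤ concaveMajorant s n t := by
  -- The constant function at the maximum is a concave majorant, so the infimum is over a nonempty
  -- set.
  refine le_csInf ⟨pathMax s n, fun _ => pathMax s n, concaveOn_const _ (convex_Icc _ _),
    fun j hj => le_pathMax hj, rfl⟩ ?_
  rintro y ⟨C, hC, hd, rfl⟩
  exact h C hC hd

/-- Every majorant is at least `s k` at `k`, so one concave majorant attaining this value already
realises the infimum. -/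
lemma isContact_of_concaveOn {k : ℕ} (hk : k ≤ n) {C : ℝ → ℝ}
    (hC : ConcaveOn ℝ (Set.Icc 0 (n : ℝ)) C) (hd : ∀ j : ℕ, j ≤ n → s j ≤ C j)
    (hCk : C k = s k) : IsContact s n k := by
  refine ⟨hk, le_antisymm (le_concaveMajorant_of_forall fun C _ h => h k hk) ?_⟩
  refine csInf_le ⟨s k, ?_⟩ ⟨C, hC, hd, hCk⟩
  rintro y ⟨C', -, h, rfl⟩
  exact h k hk

lemma isContact_argMax (s : ℕ → ℝ) (n : ℕ) : IsContact s n (argMax s n) :=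
  isContact_of_concaveOn (C := fun _ => pathMax s n) (argMax_spec s n).1
    (concaveOn_const _ (convex_Icc _ _)) (fun _ hj => le_pathMax hj) (argMax_spec s n).2.symm

lemma concaveOn_affine (u v : ℝ) {A : Set ℝ} (hA : Convex ℝ A) :
    ConcaveOn ℝ A fun t => u + v * t := by
  refine ⟨hA, fun x _ y _ a b _ _ hab => le_of_eq ?_⟩
  simp only [smul_eq_mul]
  linear_combination u * hab

/-- The sum bounds each single deviation from `s i`, and distinct integer times are at distance at
least one. A line through `(i, s i)` with this slope therefore dominates the path when `i` is an end
point, which makes both end points contact times. -/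
lemma sub_le_sum_abs_mul (s : ℕ → ℝ) (n : ℕ) {i j : ℕ} (hj : j ≤ n) {d : ℝ}
    (hd : 0 ≤ d) (h : i ≠ j → 1 ≤ d) :
    s j ≤ s i + (∑ l ∈ Finset.range (n + 1), |s l - s i|) * d := by
  set K := ∑ l ∈ Finset.range (n + 1), |s l - s i|
  have hK : |s j - s i| ≤ K :=
    Finset.single_le_sum (f := fun l => |s l - s i|) (fun _ _ => abs_nonneg _)
      (Finset.mem_range_succ_iff.2 hj)
  have h0 : 0 ≤ K := (abs_nonneg _).trans hK
  rcases eq_or_ne i j with rfl | hij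
  · nlinarith
  · nlinarith [le_abs_self (s j - s i), h hij]

lemma isContact_zero (s : ℕ → ℝ) (n : ℕ) : IsContact s n 0 := by
  refine isContact_of_concaveOn (Nat.zero_le _)
    (concaveOn_affine (s 0) (∑ l ∈ Finset.range (n + 1), |s l - s 0|) (convex_Icc _ _))
    (fun j hj => sub_le_sum_abs_mul s n hj (by positivity) fun h => ?_) (by simp)
  exact_mod_cast Nat.one_le_iff_ne_zero.2 h.symm

lemma isContact_self (s : ℕ → ℝ) (n : ℕ) : IsContact s n n := by
  set K := ∑ l ∈ Finset.range (n + 1), |s l - s n|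
  refine isContact_of_concaveOn le_rfl (concaveOn_affine (s n + K * n) (-K) (convex_Icc _ _))
    (fun j hj => ?_) (by ring)
  have hj' : (j : ℝ) ≤ n := by exact_mod_cast hj
  have := sub_le_sum_abs_mul s n (i := n) (j := j) (d := n - j) hj (by linarith) fun h => by
    have : j + 1 ≤ n := by omega
    have : (j : ℝ) + 1 ≤ n := by exact_mod_cast this
    linarith
  calc s j ≤ _ := this
    _ = _ := by ring

/-- A contact time lies above every chord of the path. -/
lemma IsContact.chord_le {a b d : ℕ} (hb : IsContact s n b) (hab : a < b) (hbd : b < d)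
    (hd : d ≤ n) : ((d : ℝ) - b) * s a + (b - a) * s d ≤ (d - a) * s b := by
  have hab' : (a : ℝ) < b := by exact_mod_cast hab
  have hbd' : (b : ℝ) < d := by exact_mod_cast hbd
  have hd' : (d : ℝ) ≤ n := by exact_mod_cast hd
  have h0 : (0 : ℝ) < d - a := by linarith
  have ha0 : (0 : ℝ) ≤ a := by positivity
  rw [mul_comm ((d : ℝ) - a), ← div_le_iff₀ h0, hb.2]
  refine le_concaveMajorant_of_forall fun C hC hdom => ?_
  -- The weights are those expressing `b` as a convex combination of `a` and `d`.
  have := hC.2 (show (a : ℝ) ∈ Set.Icc (0 : ℝ) n from ⟨ha0, by linarith⟩)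
    (show (d : ℝ) ∈ Set.Icc (0 : ℝ) n from ⟨by linarith, hd'⟩)
    (show (0 : ℝ) ≤ (d - b) / (d - a) from div_nonneg (by linarith) h0.le)
    (show (0 : ℝ) ≤ (b - a) / (d - a) from div_nonneg (by linarith) h0.le) (by field_simp; ring)
  have e : (((d : ℝ) - b) / (d - a)) • (a : ℝ) + (((b : ℝ) - a) / (d - a)) • (d : ℝ) = b := by
    simp only [smul_eq_mul]; field_simp; ring
  rw [e] at this
  refine le_trans ?_ this
  simp only [smul_eq_mul]
  rw [div_mul_eq_mul_div, div_mul_eq_mul_div, ← add_div]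
  gcongr
  · exact hdom a (by omega)
  · exact hdom d hd

/-! ### Faces and telescoping sums over them -/

lemma mem_faces {f : ℕ × ℕ} : f ∈ faces s n ↔ IsContact s n f.1 ∧ IsContact s n f.2 ∧ f.1 < f.2 ∧
    ∀ k : ℕ, f.1 < k → k < f.2 → ¬ IsContact s n k := by
  simp only [faces, Finset.mem_filter, Finset.mem_product, Finset.mem_range_succ_iff,
    and_iff_right_iff_imp]
  exact fun h => ⟨h.1.1, h.2.1.1⟩

/-- Telescoping: if `a` is the last contact time before `k`, then `(a, k)` is the only face ending
in `(a, k]`. Group-valued `g` treats length and increment together. -/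
lemma sum_faces_le {E : Type*} [AddCommGroup E] (g : ℕ → E) {k : ℕ} (hk : IsContact s n k) :
    ∑ f ∈ faces s n with f.2 ≤ k, (g f.2 - g f.1) = g k - g 0 := by
  classical
  induction k using Nat.strong_induction_on with
  | _ k ih =>
    rcases Nat.eq_zero_or_pos k with rfl | hpos
    · rw [Finset.filter_false_of_mem, Finset.sum_empty, sub_self]
      intro f hf h
      have := (mem_faces.1 hf).2.2.1
      omega
    · obtain ⟨a, ⟨hak, ha⟩, hmax⟩ : ∃ a, (a < k ∧ IsContact s n a) ∧
          ∀ c, a < c → c < k → ¬ IsContact s n c := by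
        refine ⟨Nat.findGreatest (fun a => a < k ∧ IsContact s n a) k,
          Nat.findGreatest_spec (P := fun a => a < k ∧ IsContact s n a) (Nat.zero_le k)
            ⟨hpos, isContact_zero s n⟩, fun c hc hck h => ?_⟩
        exact Nat.findGreatest_is_greatest hc hck.le ⟨hck, h⟩
      have hset : (faces s n).filter (fun f => f.2 ≤ k)
          = insert (a, k) ((faces s n).filter fun f => f.2 ≤ a) := by
        ext ⟨u, v⟩
        simp only [Finset.mem_filter, Finset.mem_insert, Prod.mk.injEq, mem_faces]
        constructor
        · rintro ⟨⟨hu, hv, huv, hno⟩, hvk⟩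
          rcases Nat.lt_or_ge a v with h | h
          · have hvk' : v = k := by
              by_contra hne
              exact hmax v h (by omega) hv
            subst hvk'
            left
            refine ⟨?_, rfl⟩
            rcases lt_trichotomy u a with h' | h' | h'
            · exact absurd ha (hno a h' hak)
            · exact h'
            · exact absurd hu (hmax u h' huv)
          · exact Or.inr ⟨⟨hu, hv, huv, hno⟩, h⟩
        · rintro (⟨rfl, rfl⟩ | ⟨h, h'⟩)
          · exact ⟨⟨ha, hk, hak, hmax⟩, le_rfl⟩
          · exact ⟨h, h'.trans hak.le⟩
      rw [hset, Finset.sum_insert (by simp [Finset.mem_filter]; omega), ih a hak ha]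
      abel

/-- The maximum time `L` is a contact time, so each face lies on one side of it. For a face `(a, b)`
with `b < L`, the chord from `a` to `L` lies below the path at `b`, and `s b < s L` then forces `s a
< s b`. The chord from `L` to `b` handles faces with `L < a` in the same way. Faces adjacent to `L`
use uniqueness of the maximum directly. -/
lemma faceIncrement_pos_iff
    (huniq : ∀ k ≤ n, k ≠ argMax s n → s k < s (argMax s n)) {f : ℕ × ℕ} (hf : f ∈ faces s n) :
    0 < faceIncrement s f ↔ f.2 ≤ argMax s n := by
  obtain ⟨a, b⟩ := f
  obtain ⟨ha, hb, hab, hno⟩ := mem_faces.1 hf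
  simp only at ha hb hab hno ⊢
  have hL := isContact_argMax s n
  set L := argMax s n
  have hab' : (a : ℝ) < b := by exact_mod_cast hab
  rw [faceIncrement, sub_pos]
  rcases Nat.lt_or_ge L b with h | h
  · refine iff_of_false (fun hlt => ?_) (by omega)
    have hLa : L ≤ a := by
      by_contra hc
      exact hno L (by omega) h hL
    have hLb := huniq b hb.1 (by omega)
    rcases hLa.eq_or_lt with e | e
    · rw [← e] at hlt
      linarith
    · have hc := ha.chord_le e hab hb.1
      have e' : (L : ℝ) < a := by exact_mod_cast e
      have := huniq a ha.1 (by omega)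
      nlinarith
  · refine iff_of_true ?_ h
    rcases h.eq_or_lt with e | e
    · subst e
      exact huniq a ha.1 (by omega)
    · have hc := hb.chord_le hab e hL.1
      have e' : (b : ℝ) < L := by exact_mod_cast e
      have := huniq b hb.1 (by omega)
      nlinarith

lemma sum_faceIncrement_pos
    (huniq : ∀ k ≤ n, k ≠ argMax s n → s k < s (argMax s n)) :
    ∑ f ∈ faces s n with 0 < faceIncrement s f, (faceLength f, faceIncrement s f)
      = ((argMax s n : ℝ), s (argMax s n) - s 0) := by
  rw [Finset.filter_congr fun f hf => faceIncrement_pos_iff huniq hf]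
  have := sum_faces_le (fun k => ((k : ℝ), s k)) (isContact_argMax s n)
  simpa [faceLength, faceIncrement] using this

lemma sum_faceIncrement_nonpos
    (huniq : ∀ k ≤ n, k ≠ argMax s n → s k < s (argMax s n)) :
    ∑ f ∈ faces s n with faceIncrement s f ≤ 0, (faceLength f, faceIncrement s f)
      = ((n : ℝ) - argMax s n, s n - s (argMax s n)) := by
  have h1 := sum_faceIncrement_pos huniq
  have h2 := Finset.sum_filter_add_sum_filter_not (faces s n) (fun f => 0 < faceIncrement s f)
    fun f => (faceLength f, faceIncrement s f)
  have h3 := sum_faces_le (fun k => ((k : ℝ), s k)) (isContact_self s n)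
  rw [Finset.filter_true_of_mem fun f hf => (mem_faces.1 hf).2.1.1] at h3
  simp only [not_lt] at h2
  have h4 : ∑ f ∈ faces s n, (faceLength f, faceIncrement s f) = ((n : ℝ), s n - s 0) := by
    simpa [faceLength, faceIncrement] using h3
  rw [h4, h1, add_comm, ← eq_sub_iff_add_eq] at h2
  rw [h2]
  simp

end Path

end RandomWalk

namespace RandomWalk

/-! ### Power series whose coefficients satisfy a convolution recursion -/

section Series

lemma summable_mul_pow {c : ℕ → ℂ} (hc : ∀ n, ‖c n‖ ≤ 1) {z : ℂ} (hz : ‖z‖ < 1) :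
    Summable fun n => ‖c n * z ^ n‖ := by
  refine Summable.of_nonneg_of_le (fun _ => norm_nonneg _) (fun n => ?_)
    (summable_geometric_of_lt_one (norm_nonneg z) hz)
  rw [norm_mul, norm_pow]
  exact mul_le_of_le_one_left (by positivity) (hc n)

lemma hasDerivAt_tsum_mul_pow {c : ℕ → ℂ} (hc : ∀ n, ‖c n‖ ≤ 1) {z : ℂ} (hz : ‖z‖ < 1) :
    HasDerivAt (fun w => ∑' n, c n * w ^ n) (∑' n : ℕ, ((n : ℂ) + 1) * c (n + 1) * z ^ n) z := by
  -- A radius strictly between `‖z‖` and `1` gives the summable uniform bound `n r ^ (n - 1)` for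
  -- the termwise derivatives.
  obtain ⟨r, hzr, hr1⟩ := exists_between hz
  have hr0 : 0 ≤ r := (norm_nonneg z).trans hzr.le
  have hu : Summable fun n : ℕ => (n : ℝ) * r ^ (n - 1) := by
    rw [← summable_nat_add_iff 1]
    have h1 := summable_pow_mul_geometric_of_norm_lt_one 1 (r := r)
      (by rwa [Real.norm_of_nonneg hr0])
    have h2 := summable_geometric_of_lt_one hr0 hr1
    refine (h1.add h2).congr fun n => ?_
    simp only [Nat.add_sub_cancel, pow_one]
    push_cast
    ring
  have hbound : ∀ n (w : ℂ), w ∈ Metric.ball (0 : ℂ) r →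
      ‖c n * ((n : ℂ) * w ^ (n - 1))‖ ≤ (n : ℝ) * r ^ (n - 1) := by
    intro n w hw
    rw [mem_ball_zero_iff] at hw
    rw [norm_mul, norm_mul, norm_pow, Complex.norm_natCast]
    calc ‖c n‖ * (n * ‖w‖ ^ (n - 1)) ≤ 1 * (n * r ^ (n - 1)) := by
          gcongr
          exact hc n
      _ = _ := one_mul _
  have hzb : z ∈ Metric.ball (0 : ℂ) r := by simpa using hzr
  have h := hasDerivAt_tsum_of_isPreconnected (g := fun n w => c n * w ^ n)
    (g' := fun n w => c n * ((n : ℂ) * w ^ (n - 1))) hu Metric.isOpen_ball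
    (convex_ball (0 : ℂ) r).isPreconnected
    (fun n w _ => (hasDerivAt_pow n w).const_mul (c n)) hbound hzb
    (summable_mul_pow hc hz).of_norm hzb
  have hs : Summable fun n : ℕ => c n * ((n : ℂ) * z ^ (n - 1)) :=
    Summable.of_norm_bounded hu fun n => hbound n z hzb
  rw [hs.tsum_eq_zero_add] at h
  simp only [Nat.cast_zero, zero_mul, mul_zero, zero_add, Nat.add_sub_cancel] at h
  have e : ∑' n : ℕ, ((n : ℂ) + 1) * c (n + 1) * z ^ n
      = ∑' n : ℕ, c (n + 1) * (((n + 1 : ℕ) : ℂ) * z ^ n) :=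
    tsum_congr fun n => by push_cast; ring
  rwa [e]

/-- A power series whose coefficients satisfy `(n + 1) α (n + 1) = ∑ π j * α (n - j)` is the
exponential of `∑ π n z ^ (n + 1) / (n + 1)`. -/
lemma tsum_mul_pow_eq_exp {α π : ℕ → ℂ} (hα : ∀ n, ‖α n‖ ≤ 1) (hπ : ∀ n, ‖π n‖ ≤ 1)
    (hα0 : α 0 = 1)
    (hrec : ∀ n : ℕ, ((n : ℂ) + 1) * α (n + 1) = ∑ j ∈ Finset.range (n + 1), π j * α (n - j))
    {z : ℂ} (hz : ‖z‖ < 1) :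
    ∑' n, α n * z ^ n = Complex.exp (∑' n : ℕ, π n / ((n : ℂ) + 1) * z ^ (n + 1)) := by
  -- The exponent is reindexed as a power series in `w ^ n`; its constant term vanishes since
  -- division by zero gives zero.
  set c : ℕ → ℂ := fun n => π (n - 1) / n with hc_def
  have hc : ∀ n, ‖c n‖ ≤ 1 := by
    intro n
    rcases Nat.eq_zero_or_pos n with rfl | hn
    · simp [c]
    · have : (1 : ℝ) ≤ n := by exact_mod_cast hn
      rw [hc_def, norm_div, Complex.norm_natCast]
      exact div_le_one_of_le₀ ((hπ _).trans this) (by positivity)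
  set F : ℂ → ℂ := fun w => ∑' n, α n * w ^ n
  set G : ℂ → ℂ := fun w => ∑' n, c n * w ^ n
  have hF0 : F 0 = 1 := by
    simp only [F]
    rw [tsum_eq_single 0 fun n hn => by simp [hn]]
    simp [hα0]
  have hG0 : G 0 = 0 := by
    simp only [G]
    rw [tsum_eq_single 0 fun n hn => by simp [hn]]
    simp [c]
  -- By the Cauchy product the recursion says `F' = G' F`, so `F exp (-G)` is constant on the disc.
  have hder : ∀ w ∈ Metric.ball (0 : ℂ) 1,
      HasDerivAt (fun w => F w * Complex.exp (-G w)) 0 w := by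
    intro w hw
    rw [mem_ball_zero_iff] at hw
    have hF := hasDerivAt_tsum_mul_pow hα hw
    have hG := hasDerivAt_tsum_mul_pow hc hw
    have e1 : ∑' n : ℕ, ((n : ℂ) + 1) * c (n + 1) * w ^ n = ∑' n, π n * w ^ n := by
      refine tsum_congr fun n => ?_
      have : (n : ℂ) + 1 ≠ 0 := by exact_mod_cast Nat.succ_ne_zero n
      simp only [c, Nat.add_sub_cancel]
      push_cast
      field_simp
    have e2 : ∑' n : ℕ, ((n : ℂ) + 1) * α (n + 1) * w ^ n
        = (∑' n, π n * w ^ n) * F w := by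
      rw [tsum_mul_tsum_eq_tsum_sum_range_of_summable_norm (summable_mul_pow hπ hw)
        (summable_mul_pow hα hw)]
      refine tsum_congr fun n => ?_
      rw [hrec, Finset.sum_mul]
      refine Finset.sum_congr rfl fun j hj => ?_
      have : j + (n - j) = n := by have := Finset.mem_range.1 hj; omega
      calc π j * α (n - j) * w ^ n = π j * α (n - j) * w ^ (j + (n - j)) := by rw [this]
        _ = _ := by rw [pow_add]; ring
    rw [e1] at hG
    rw [e2] at hF
    refine (hF.mul hG.neg.cexp).congr_deriv ?_
    ring
  have hconst := Metric.isOpen_ball.is_const_of_deriv_eq_zero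
    (convex_ball (0 : ℂ) 1).isPreconnected
    (fun w hw => (hder w hw).differentiableAt.differentiableWithinAt)
    (fun w hw => (hder w hw).deriv) (x := z) (y := 0) (by simpa using hz) (by simp)
  simp only [hF0, hG0, neg_zero, Complex.exp_zero, mul_one] at hconst
  have hG : G z = ∑' n : ℕ, π n / ((n : ℂ) + 1) * z ^ (n + 1) := by
    simp only [G]
    rw [(summable_mul_pow hc hz).of_norm.tsum_eq_zero_add]
    simp [c]
  rw [← hG]
  calc F z = F z * Complex.exp (-G z) * Complex.exp (G z) := by
        rw [mul_assoc, ← Complex.exp_add]; simp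
    _ = Complex.exp (G z) := by rw [hconst, one_mul]

end Series

/-! ### Compound Poisson distributions -/

section CompoundPoisson

variable {E : Type*} [NormedAddCommGroup E] [NormedSpace ℝ E] [MeasurableSpace E] [BorelSpace E]
  [SecondCountableTopology E]

omit [NormedSpace ℝ E] [BorelSpace E] [SecondCountableTopology E] in
lemma compoundPoisson_eq_sum (r : ℝ≥0) (ρ : Measure E) :
    compoundPoisson r ρ = Measure.sum fun k : ℕ =>
      ENNReal.ofReal (Real.exp (-r) * r ^ k / k.factorial) •
        (Measure.pi fun _ : Fin k => ρ).map fun y => ∑ i, y i := by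
  rw [compoundPoisson, poissonMeasure, Measure.bind_sum _ _ .of_discrete]
  simp_rw [Measure.bind_smul]
  congr 1
  funext k
  rw [Measure.dirac_bind .of_discrete]

instance (r : ℝ≥0) (ρ : Measure E) [IsProbabilityMeasure ρ] :
    IsProbabilityMeasure (compoundPoisson r ρ) := by
  constructor
  have h : ∀ k : ℕ, ((Measure.pi fun _ : Fin k => ρ).map fun y => ∑ i, y i) Set.univ = 1 := by
    intro k
    rw [Measure.map_apply (by fun_prop) .univ, Set.preimage_univ, measure_univ]
  have h' := (hasSum_one_poissonMeasure r)
  rw [compoundPoisson_eq_sum, Measure.sum_apply _ .univ]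
  simp only [Measure.smul_apply, h, smul_eq_mul, mul_one]
  rw [← ENNReal.ofReal_tsum_of_nonneg (fun _ => by positivity) h'.summable, h'.tsum_eq]
  simp

omit [SecondCountableTopology E] in
lemma integrable_cexp_dual (μ : Measure E) [IsFiniteMeasure μ] (l : StrongDual ℝ E) :
    Integrable (fun x => Complex.exp (l x * Complex.I)) μ := by
  refine Integrable.of_bound (by fun_prop) 1 (ae_of_all _ fun x => ?_)
  rw [Complex.norm_exp_ofReal_mul_I]

lemma charFunDual_map_sum_pi (ρ : Measure E) [IsProbabilityMeasure ρ] (k : ℕ)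
    (l : StrongDual ℝ E) :
    charFunDual ((Measure.pi fun _ : Fin k => ρ).map fun y => ∑ i, y i) l
      = charFunDual ρ l ^ k := by
  rw [charFunDual_apply, integral_map (by fun_prop) (by fun_prop)]
  have := integral_fintype_prod_eq_pow (ι := Fin k) (μ := ρ)
    (fun x : E => Complex.exp (l x * Complex.I))
  rw [Fintype.card_fin] at this
  rw [charFunDual_apply, ← this]
  congr 1
  funext y
  rw [← Complex.exp_sum, map_sum, Complex.ofReal_sum, Finset.sum_mul]

/-- A sum of `k` independent jumps contributes the `k`-th power of the characteristic function of
`ρ`, and the Poisson weights turn these powers into an exponential series. -/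
lemma charFunDual_compoundPoisson (r : ℝ≥0) (ρ : Measure E) [IsProbabilityMeasure ρ]
    (l : StrongDual ℝ E) :
    charFunDual (compoundPoisson r ρ) l = Complex.exp (r * charFunDual ρ l - r) := by
  have hint := integrable_cexp_dual (compoundPoisson r ρ) l
  rw [charFunDual_apply]
  rw [compoundPoisson_eq_sum] at hint ⊢
  rw [integral_sum_measure hint]
  simp_rw [integral_smul_measure, ← charFunDual_apply, charFunDual_map_sum_pi]
  have hexp : Complex.exp (r * charFunDual ρ l)
      = ∑' k : ℕ, (r * charFunDual ρ l) ^ k / (k.factorial : ℂ) := by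
    rw [Complex.exp_eq_exp_ℂ, NormedSpace.exp_eq_tsum_div]
  rw [sub_eq_add_neg, Complex.exp_add, mul_comm, hexp, ← tsum_mul_left]
  refine tsum_congr fun k => ?_
  rw [ENNReal.toReal_ofReal (by positivity), Complex.real_smul]
  push_cast
  ring

/-- A probability measure with characteristic function `exp (ν̂ - ν(E))` is compound Poisson. -/
lemma isCompoundPoisson_of_charFunDual [CompleteSpace E] {μ ν : Measure E}
    [IsProbabilityMeasure μ] [IsFiniteMeasure ν]
    (h : ∀ l, charFunDual μ l = Complex.exp (charFunDual ν l - ν.real Set.univ)) :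
    IsCompoundPoisson μ ν := by
  have key : ∀ (r : ℝ≥0) (ρ : Measure E), IsProbabilityMeasure ρ → ν = (r : ℝ≥0∞) • ρ →
      IsCompoundPoisson μ ν := by
    intro r ρ hρ hν
    refine ⟨r, ρ, hρ, hν, Measure.ext_of_charFunDual (funext fun l => ?_)⟩
    rw [h, charFunDual_compoundPoisson, hν]
    simp [charFunDual_apply, measureReal_def, NNReal.smul_def]
  -- A zero intensity cannot be normalised; rate zero with an arbitrary jump law covers it.
  by_cases h0 : ν = 0
  · exact key 0 (Measure.dirac 0) inferInstance (by simp [h0])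
  · have h1 : ν Set.univ ≠ 0 := by simpa using h0
    have h2 : ν Set.univ ≠ ∞ := measure_ne_top _ _
    refine key (ν Set.univ).toNNReal ((ν Set.univ)⁻¹ • ν) ⟨?_⟩ ?_
    · simp [ENNReal.inv_mul_cancel h1 h2]
    · rw [ENNReal.coe_toNNReal h2, smul_smul, ENNReal.mul_inv_cancel h1 h2, one_smul]

end CompoundPoisson

/-! ### Mixtures of measures on the lines `{v n} × ℝ` -/

section Layers

/-- The measure on `ℝ × ℝ` given on the lines `{v n} × ℝ` by the multiples `c n` of `a n`. -/
noncomputable def layers (c v : ℕ → ℝ) (a : ℕ → Measure ℝ) : Measure (ℝ × ℝ) :=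
  Measure.sum fun n => ENNReal.ofReal (c n) • (a n).map fun x => (v n, x)

variable {c v : ℕ → ℝ} {a : ℕ → Measure ℝ}

lemma isFiniteMeasure_layers (hc : Summable c)
    (ha : ∀ n, a n Set.univ ≤ 1) : IsFiniteMeasure (layers c v a) := by
  constructor
  rw [layers, Measure.sum_apply _ .univ]
  refine lt_of_le_of_lt (ENNReal.tsum_le_tsum fun n => ?_) hc.tsum_ofReal_lt_top
  rw [Measure.smul_apply, Measure.map_apply (by fun_prop) .univ, smul_eq_mul]
  exact mul_le_of_le_one_right' (ha n)

/-- A functional on `ℝ × ℝ` is affine along the line at `v n`, so that layer contributes a phase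
times a one-dimensional characteristic function. -/
lemma charFunDual_layers [IsFiniteMeasure (layers c v a)] (hc0 : ∀ n, 0 ≤ c n)
    (l : StrongDual ℝ (ℝ × ℝ)) :
    charFunDual (layers c v a) l
      = ∑' n, c n * (Complex.exp (v n * l (1, 0) * Complex.I) * charFun (a n) (l (0, 1))) := by
  have hint := integrable_cexp_dual (layers c v a) l
  rw [charFunDual_apply]
  rw [layers] at hint ⊢
  rw [integral_sum_measure hint]
  refine tsum_congr fun n => ?_
  rw [integral_smul_measure, integral_map (by fun_prop) (by fun_prop),
    ENNReal.toReal_ofReal (hc0 n), Complex.real_smul, charFun_apply_real]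
  congr 1
  rw [← integral_const_mul]
  refine integral_congr_ae (.of_forall fun x => ?_)
  dsimp only
  have : l (v n, x) = v n * l (1, 0) + l (0, 1) * x := by
    have : ((v n, x) : ℝ × ℝ) = v n • (1, 0) + x • (0, 1) := by simp
    rw [this, map_add, map_smul, map_smul, smul_eq_mul, smul_eq_mul]
    ring
  rw [this, ← Complex.exp_add]
  push_cast
  ring_nf

lemma norm_charFun_le_of_measure_univ_le {μ : Measure ℝ} (h : μ Set.univ ≤ 1) (t : ℝ) :
    ‖charFun μ t‖ ≤ 1 := by
  refine (norm_charFun_le t).trans ?_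
  rw [measureReal_def]
  exact ENNReal.toReal_le_of_le_ofReal zero_le_one (by simpa using h)

/-- If the measures `a n` satisfy `(n + 1) a (n + 1) = ∑ p j ∗ a (n - j)`, then their mixture
with weights `q ^ n` is an exponential of the mixture of the `p n` with weights
`q ^ (n + 1) / (n + 1)`. -/
lemma charFunDual_layers_eq_exp {a p : ℕ → Measure ℝ} (ha : ∀ n, a n Set.univ ≤ 1)
    (hp : ∀ n, p n Set.univ ≤ 1) (ha0 : a 0 = Measure.dirac 0)
    (hrec : ∀ (t : ℝ) (n : ℕ), ((n : ℂ) + 1) * charFun (a (n + 1)) t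
      = ∑ j ∈ Finset.range (n + 1), charFun (p j) t * charFun (a (n - j)) t)
    {q : ℝ} (hq0 : 0 ≤ q) (hq1 : q < 1) :
    IsFiniteMeasure (layers (fun n => q ^ n) (fun n => n) a) ∧
    IsFiniteMeasure (layers (fun n => q ^ (n + 1) / ((n : ℝ) + 1)) (fun n => (n : ℝ) + 1) p) ∧
    ∀ l, charFunDual (layers (fun n => q ^ n) (fun n => n) a) l = Complex.exp (charFunDual
      (layers (fun n => q ^ (n + 1) / ((n : ℝ) + 1)) (fun n => (n : ℝ) + 1) p) l) := by
  have hs := summable_geometric_of_lt_one hq0 hq1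
  have f1 : IsFiniteMeasure (layers (fun n => q ^ n) (fun n => n) a) :=
    isFiniteMeasure_layers hs ha
  have f2 : IsFiniteMeasure
      (layers (fun n => q ^ (n + 1) / ((n : ℝ) + 1)) (fun n => (n : ℝ) + 1) p) := by
    refine isFiniteMeasure_layers
      (Summable.of_nonneg_of_le (fun n => by positivity) (fun n => ?_)
        ((summable_nat_add_iff 1).2 hs)) hp
    exact div_le_self (by positivity) (by linarith [(Nat.cast_nonneg n : (0 : ℝ) ≤ n)])
  refine ⟨f1, f2, fun l => ?_⟩
  rw [charFunDual_layers (fun n => by positivity), charFunDual_layers (fun n => by positivity)]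
  set t := l (0, 1)
  -- The weight `q ^ n` and the phase of layer `n` combine to `z ^ n`, with `‖z‖ = q < 1`.
  set z : ℂ := q * Complex.exp (l (1, 0) * Complex.I) with hz_def
  have hz : ‖z‖ < 1 := by
    rw [hz_def, norm_mul, Complex.norm_exp_ofReal_mul_I, mul_one, Complex.norm_real,
      Real.norm_of_nonneg hq0]
    exact hq1
  have hpow : ∀ n : ℕ, z ^ n = q ^ n * Complex.exp (n * l (1, 0) * Complex.I) := by
    intro n
    rw [hz_def, mul_pow, ← Complex.exp_nat_mul, mul_assoc (n : ℂ)]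
  have := tsum_mul_pow_eq_exp (α := fun n => charFun (a n) t) (π := fun n => charFun (p n) t)
    (fun n => norm_charFun_le_of_measure_univ_le (ha n) t)
    (fun n => norm_charFun_le_of_measure_univ_le (hp n) t)
    (by simp [ha0]) (hrec t) hz
  simp only [hpow] at this
  convert this using 2
  · funext n
    push_cast
    ring
  · congr 1
    funext n
    push_cast
    ring

end Layers

end RandomWalk

namespace RandomWalk

open Finset.HasAntidiagonal (antidiagonal mem_antidiagonal)

/-! ### The factorisation of the law of a random walk at its maximum -/

section Walk

lemma walk_zero (x : ℕ → ℝ) : walk x 0 = 0 := by simp [walk]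

@[fun_prop]
lemma measurable_walk (n : ℕ) : Measurable fun x : ℕ → ℝ => walk x n := by
  unfold walk
  fun_prop

/-- The increments after time `k`. -/
def shift (k : ℕ) (x : ℕ → ℝ) : ℕ → ℝ := fun i => x (k + i)

/-- The increments up to time `k`, continued by `0`. -/
noncomputable def trunc (k : ℕ) (x : ℕ → ℝ) : ℕ → ℝ := fun i => if i < k then x i else 0

@[fun_prop]
lemma measurable_shift (k : ℕ) : Measurable (shift k) := by
  unfold shift
  fun_prop

@[fun_prop]
lemma measurable_trunc (k : ℕ) : Measurable (trunc k) := by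
  refine measurable_pi_lambda _ fun i => ?_
  unfold trunc
  split_ifs <;> fun_prop

lemma walk_add (x : ℕ → ℝ) (k j : ℕ) : walk x (k + j) = walk x k + walk (shift k x) j := by
  simp [walk, shift, Finset.sum_range_add]

lemma walk_trunc (x : ℕ → ℝ) {k j : ℕ} (hj : j ≤ k) : walk (trunc k x) j = walk x j := by
  refine Finset.sum_congr rfl fun i hi => if_pos ?_
  have := Finset.mem_range.1 hi
  omega

/-- The paths whose value at time `k` exceeds all previous values. -/
def ladder (k : ℕ) : Set (ℕ → ℝ) := {x | ∀ j < k, walk x j < walk x k}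

/-- The paths that are nonpositive up to time `m`. -/
def below (m : ℕ) : Set (ℕ → ℝ) := {x | ∀ j ≤ m, walk x j ≤ 0}

/-- The paths whose first maximum up to time `n` is at time `k`. -/
def maxAt (n k : ℕ) : Set (ℕ → ℝ) := {x | argMax (walk x) n = k}

lemma measurableSet_ladder (k : ℕ) : MeasurableSet (ladder k) := by
  simp only [ladder, Set.ofPred_forall]
  exact .iInter fun j => .iInter fun _ => measurableSet_lt (by fun_prop) (by fun_prop)

lemma measurableSet_below (m : ℕ) : MeasurableSet (below m) := by
  simp only [below, Set.ofPred_forall]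
  exact .iInter fun j => .iInter fun _ => measurableSet_le (by fun_prop) (by fun_prop)

lemma trunc_mem_ladder {k : ℕ} {x : ℕ → ℝ} : trunc k x ∈ ladder k ↔ x ∈ ladder k := by
  refine forall₂_congr fun j hj => ?_
  rw [walk_trunc x hj.le, walk_trunc x le_rfl]

/-- Being a strict record at `k` concerns the first `k` increments; not exceeding that record
afterwards concerns only the shifted increments. -/
lemma mem_maxAt_add {x : ℕ → ℝ} {k m : ℕ} :
    x ∈ maxAt (k + m) k ↔ x ∈ ladder k ∧ shift k x ∈ below m := by
  rw [maxAt, Set.mem_ofPred_eq, argMax_eq_iff]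
  constructor
  · rintro ⟨-, h1, h2⟩
    refine ⟨h1, fun j hj => ?_⟩
    have := h2 (k + j) (by omega)
    rw [walk_add] at this
    linarith
  · rintro ⟨h1, h2⟩
    refine ⟨by omega, h1, fun j hj => ?_⟩
    rcases Nat.lt_or_ge j k with h | h
    · exact (h1 j h).le
    · obtain ⟨i, rfl⟩ := Nat.exists_eq_add_of_le h
      have := h2 i (by omega)
      rw [walk_add]
      linarith

/-! ### Laws of the walk before and after its maximum -/

variable (μ : Measure ℝ) [IsProbabilityMeasure μ]

/-- The law of the increments of the random walk with step distribution `μ`. -/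
noncomputable abbrev iidLaw : Measure (ℕ → ℝ) := Measure.infinitePi fun _ : ℕ => μ

/-- The law of the random walk with step distribution `μ` at time `n`. -/
noncomputable def walkLaw (n : ℕ) : Measure ℝ := (iidLaw μ).map fun x => walk x n

/-- The law of the random walk at time `k`, on the event that it then exceeds all its previous
values. -/
noncomputable def ladderLaw (k : ℕ) : Measure ℝ :=
  ((iidLaw μ).restrict (ladder k)).map fun x => walk x k

/-- The law of the random walk at time `m`, on the event that it has been nonpositive so far. -/
noncomputable def belowLaw (m : ℕ) : Measure ℝ :=
  ((iidLaw μ).restrict (below m)).map fun x => walk x m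

lemma map_shift_iidLaw (k : ℕ) : (iidLaw μ).map (shift k) = iidLaw μ :=
  Measure.map_infinitePi_infinitePi_of_inj (P := fun _ : ℕ => μ) (add_right_injective k)

lemma indepFun_trunc_shift (k : ℕ) : IndepFun (trunc k) (shift k) (iidLaw μ) := by
  have hX : iIndepFun (fun (i : ℕ) (x : ℕ → ℝ) => x i) (iidLaw μ) :=
    iIndepFun_infinitePi (X := fun _ x => x) (fun _ => measurable_id)
  -- Independence from the infinite future reduces to finitely many future coordinates, whose index
  -- set is disjoint from `range k`.
  have h : IndepFun (fun (x : ℕ → ℝ) (i : Finset.range k) => x i) (shift k) (iidLaw μ) := by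
    refine IndepFun.indepFun_process (Y := fun (i : ℕ) (x : ℕ → ℝ) => x (k + i))
      (by fun_prop) (by fun_prop) fun J => ?_
    have hdisj : Disjoint (Finset.range k) (J.map (addLeftEmbedding k)) := by
      rw [Finset.disjoint_left]
      intro i hi hi'
      obtain ⟨j, -, rfl⟩ := Finset.mem_map.1 hi'
      have := Finset.mem_range.1 hi
      simp only [addLeftEmbedding_apply] at this
      omega
    have := hX.indepFun_finset _ _ hdisj (fun i => by fun_prop)
    exact this.comp (φ := id)
      (ψ := fun y (j : J) => y ⟨k + j, Finset.mem_map_of_mem (addLeftEmbedding k) j.2⟩)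
      measurable_id (by fun_prop)
  have hφ : Measurable fun (y : Finset.range k → ℝ) (i : ℕ) =>
      if h : i < k then y ⟨i, Finset.mem_range.2 h⟩ else 0 := by
    refine measurable_pi_lambda _ fun i => ?_
    split_ifs <;> fun_prop
  exact h.comp hφ measurable_id

lemma measure_trunc_inter_shift (k : ℕ) {A B : Set (ℕ → ℝ)} (hA : MeasurableSet A)
    (hB : MeasurableSet B) :
    iidLaw μ (trunc k ⁻¹' A ∩ shift k ⁻¹' B) = iidLaw μ (trunc k ⁻¹' A) * iidLaw μ B := by
  rw [(indepFun_trunc_shift μ k).measure_inter_preimage_eq_mul _ _ hA hB,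
    ← Measure.map_apply (measurable_shift k) hB, map_shift_iidLaw]

lemma integral_trunc_mul_shift (k : ℕ) {f g : (ℕ → ℝ) → ℂ} (hf : Measurable f)
    (hg : Measurable g) :
    ∫ x, f (trunc k x) * g (shift k x) ∂iidLaw μ
      = (∫ x, f (trunc k x) ∂iidLaw μ) * ∫ x, g x ∂iidLaw μ := by
  rw [(indepFun_trunc_shift μ k).integral_fun_comp_mul_comp (by fun_prop) (by fun_prop)
    hf.aestronglyMeasurable hg.aestronglyMeasurable]
  congr 1
  rw [← integral_map (f := g) (by fun_prop) hg.aestronglyMeasurable, map_shift_iidLaw]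

lemma measure_maxAt_eq_mul (k m : ℕ) {U V : Set ℝ} (hU : MeasurableSet U) (hV : MeasurableSet V) :
    iidLaw μ {x | x ∈ maxAt (k + m) k ∧ walk x k ∈ U ∧ walk x (k + m) - walk x k ∈ V}
      = ladderLaw μ k U * belowLaw μ m V := by
  have hset : {x | x ∈ maxAt (k + m) k ∧ walk x k ∈ U ∧ walk x (k + m) - walk x k ∈ V}
      = trunc k ⁻¹' ((fun x => walk x k) ⁻¹' U ∩ ladder k)
        ∩ shift k ⁻¹' ((fun x => walk x m) ⁻¹' V ∩ below m) := by
    ext x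
    simp only [Set.mem_ofPred_eq, mem_maxAt_add, Set.mem_inter_iff, Set.mem_preimage,
      trunc_mem_ladder, walk_trunc x le_rfl, walk_add, add_sub_cancel_left]
    tauto
  have hU' : MeasurableSet ((fun x => walk x k) ⁻¹' U) := measurable_walk k hU
  have hV' : MeasurableSet ((fun x => walk x m) ⁻¹' V) := measurable_walk m hV
  rw [hset, measure_trunc_inter_shift μ k (hU'.inter (measurableSet_ladder k))
    (hV'.inter (measurableSet_below m)), ladderLaw, belowLaw,
    Measure.map_apply (by fun_prop) hU, Measure.map_apply (by fun_prop) hV,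
    Measure.restrict_apply hU', Measure.restrict_apply hV']
  congr 2
  ext x
  simp only [Set.mem_inter_iff, Set.mem_preimage, trunc_mem_ladder, walk_trunc x le_rfl]

omit [IsProbabilityMeasure μ] in
lemma charFun_walkLaw (n : ℕ) (t : ℝ) :
    charFun (walkLaw μ n) t = ∫ x, Complex.exp (t * walk x n * Complex.I) ∂iidLaw μ := by
  rw [walkLaw, charFun_apply_real, integral_map (by fun_prop) (by fun_prop)]

omit [IsProbabilityMeasure μ] in
lemma charFun_ladderLaw (k : ℕ) (t : ℝ) :
    charFun (ladderLaw μ k) t = ∫ x, (ladder k).indicator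
      (fun x => Complex.exp (t * walk x k * Complex.I)) x ∂iidLaw μ := by
  rw [ladderLaw, charFun_apply_real, integral_map (by fun_prop) (by fun_prop),
    integral_indicator (measurableSet_ladder k)]

omit [IsProbabilityMeasure μ] in
lemma charFun_belowLaw (m : ℕ) (t : ℝ) :
    charFun (belowLaw μ m) t = ∫ x, (below m).indicator
      (fun x => Complex.exp (t * walk x m * Complex.I)) x ∂iidLaw μ := by
  rw [belowLaw, charFun_apply_real, integral_map (by fun_prop) (by fun_prop),
    integral_indicator (measurableSet_below m)]

lemma charFun_walkLaw_add (k m : ℕ) (t : ℝ) :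
    charFun (walkLaw μ (k + m)) t = charFun (walkLaw μ k) t * charFun (walkLaw μ m) t := by
  have := integral_trunc_mul_shift μ k (f := fun x => Complex.exp (t * walk x k * Complex.I))
    (g := fun x => Complex.exp (t * walk x m * Complex.I)) (by fun_prop) (by fun_prop)
  simp only [walk_trunc _ le_rfl] at this
  rw [charFun_walkLaw, charFun_walkLaw, charFun_walkLaw, ← this]
  congr 1
  funext x
  rw [← Complex.exp_add, walk_add]
  push_cast
  ring_nf

lemma integral_indicator_maxAt_eq_mul (k m : ℕ) (t : ℝ) :
    ∫ x, (maxAt (k + m) k).indicator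
        (fun x => Complex.exp (t * walk x (k + m) * Complex.I)) x ∂iidLaw μ
      = charFun (ladderLaw μ k) t * charFun (belowLaw μ m) t := by
  have := integral_trunc_mul_shift μ k
    (f := (ladder k).indicator fun x => Complex.exp (t * walk x k * Complex.I))
    (g := (below m).indicator fun x => Complex.exp (t * walk x m * Complex.I))
    (Measurable.indicator (by fun_prop) (measurableSet_ladder k))
    (Measurable.indicator (by fun_prop) (measurableSet_below m))
  have e : ∀ x, (ladder k).indicator (fun x => Complex.exp (t * walk x k * Complex.I)) (trunc k x)
      = (ladder k).indicator (fun x => Complex.exp (t * walk x k * Complex.I)) x := by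
    intro x
    by_cases h : x ∈ ladder k
    · rw [Set.indicator_of_mem h, Set.indicator_of_mem (trunc_mem_ladder.2 h), walk_trunc _ le_rfl]
    · rw [Set.indicator_of_notMem h, Set.indicator_of_notMem (mt trunc_mem_ladder.1 h)]
  simp only [e] at this
  rw [charFun_ladderLaw, charFun_belowLaw, ← this]
  congr 1
  funext x
  by_cases h1 : x ∈ ladder k
  · by_cases h2 : shift k x ∈ below m
    · rw [Set.indicator_of_mem (mem_maxAt_add.2 ⟨h1, h2⟩), Set.indicator_of_mem h1,
        Set.indicator_of_mem h2, ← Complex.exp_add, walk_add]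
      push_cast
      ring_nf
    · rw [Set.indicator_of_notMem fun h => h2 (mem_maxAt_add.1 h).2,
        Set.indicator_of_notMem h2, mul_zero]
  · rw [Set.indicator_of_notMem fun h => h1 (mem_maxAt_add.1 h).1,
      Set.indicator_of_notMem h1, zero_mul]

lemma measurableSet_maxAt_add (k m : ℕ) :
    MeasurableSet (maxAt (k + m) k) := by
  have : maxAt (k + m) k = ladder k ∩ shift k ⁻¹' below m := by
    ext x
    exact mem_maxAt_add
  rw [this]
  exact (measurableSet_ladder k).inter (measurable_shift k (measurableSet_below m))

/-- The first maximum time takes exactly one value in `{0, …, n}`, so the events `maxAt n k`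
partition the path space. This is the probabilistic Wiener–Hopf factorisation, coefficient by
coefficient. -/
lemma sum_ladderLaw_mul_belowLaw (n : ℕ) (t : ℝ) :
    ∑ p ∈ antidiagonal n, charFun (ladderLaw μ p.1) t * charFun (belowLaw μ p.2) t
      = charFun (walkLaw μ n) t := by
  have e : ∀ p ∈ antidiagonal n, charFun (ladderLaw μ p.1) t * charFun (belowLaw μ p.2) t
      = ∫ x, (maxAt n p.1).indicator
        (fun x => Complex.exp (t * walk x n * Complex.I)) x ∂iidLaw μ := by
    intro p hp
    rw [← integral_indicator_maxAt_eq_mul, mem_antidiagonal.1 hp]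
  rw [Finset.sum_congr rfl e, ← integral_finsetSum, charFun_walkLaw]
  · congr 1
    funext x
    have hle := (argMax_spec (walk x) n).1
    rw [Finset.sum_eq_single (argMax (walk x) n, n - argMax (walk x) n)]
    · have hx : x ∈ maxAt n (argMax (walk x) n) := by rw [maxAt, Set.mem_ofPred_eq]
      simp [Set.indicator_of_mem hx]
    · rintro ⟨i, j⟩ hp hne
      refine Set.indicator_of_notMem (fun h => hne ?_) _
      have h1 : argMax (walk x) n = i := h
      have h2 := mem_antidiagonal.1 hp
      simp only at h2
      ext <;> simp only <;> omega
    · intro h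
      simp only [mem_antidiagonal] at h
      omega
  · intro p hp
    have hm : MeasurableSet (maxAt n p.1) := by
      rw [← mem_antidiagonal.1 hp]
      exact measurableSet_maxAt_add _ _
    refine Integrable.indicator (Integrable.of_bound (by fun_prop) 1 (.of_forall fun x => ?_)) hm
    rw [← Complex.ofReal_mul, Complex.norm_exp_ofReal_mul_I]

instance (n : ℕ) : IsProbabilityMeasure (walkLaw μ n) :=
  Measure.isProbabilityMeasure_map (by fun_prop)

lemma ladderLaw_univ_le (k : ℕ) : ladderLaw μ k Set.univ ≤ 1 := by
  rw [ladderLaw, Measure.map_apply (by fun_prop) .univ]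
  exact (Measure.restrict_apply_le _ _).trans prob_le_one

lemma belowLaw_univ_le (m : ℕ) : belowLaw μ m Set.univ ≤ 1 := by
  rw [belowLaw, Measure.map_apply (by fun_prop) .univ]
  exact (Measure.restrict_apply_le _ _).trans prob_le_one

lemma ladderLaw_zero : ladderLaw μ 0 = Measure.dirac 0 := by
  have : ladder 0 = Set.univ := by simp [ladder]
  simp [ladderLaw, this, walk_zero, Measure.map_const]

lemma belowLaw_zero : belowLaw μ 0 = Measure.dirac 0 := by
  have : below 0 = Set.univ := by simp [below, walk_zero]
  simp [belowLaw, this, walk_zero, Measure.map_const]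

omit [IsProbabilityMeasure μ] in
lemma ladderLaw_succ_Iic (k : ℕ) : ladderLaw μ (k + 1) (Set.Iic 0) = 0 := by
  rw [ladderLaw, Measure.map_apply (by fun_prop) measurableSet_Iic,
    Measure.restrict_apply (measurable_walk _ measurableSet_Iic)]
  convert measure_empty (μ := iidLaw μ)
  ext x
  simp only [Set.mem_inter_iff, Set.mem_preimage, Set.mem_Iic, Set.mem_empty_iff_false, iff_false,
    not_and]
  intro h h'
  have := h' 0 (by omega)
  rw [walk_zero] at this
  linarith

omit [IsProbabilityMeasure μ] in
lemma belowLaw_Ioi (m : ℕ) : belowLaw μ m (Set.Ioi 0) = 0 := by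
  rw [belowLaw, Measure.map_apply (by fun_prop) measurableSet_Ioi,
    Measure.restrict_apply (measurable_walk _ measurableSet_Ioi)]
  convert measure_empty (μ := iidLaw μ)
  ext x
  simp only [Set.mem_inter_iff, Set.mem_preimage, Set.mem_Ioi, Set.mem_empty_iff_false, iff_false,
    not_and]
  intro h h'
  have := h' m le_rfl
  linarith

end Walk

/-! ### Uniqueness of the factorisation -/

section Factorisation

/-- Restriction to each of the two complementary half-lines recovers the corresponding summand. -/
lemma eq_of_add_eq_add {a b a' b' : Measure ℝ} (ha : a (Set.Iic 0) = 0)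
    (ha' : a' (Set.Iic 0) = 0) (hb : b (Set.Ioi 0) = 0) (hb' : b' (Set.Ioi 0) = 0)
    (h : a + b = a' + b') : a = a' ∧ b = b' := by
  have r1 : ∀ m : Measure ℝ, m (Set.Iic 0) = 0 → m.restrict (Set.Ioi 0) = m := fun m hm =>
    Measure.restrict_eq_self_of_ae_mem (by
      filter_upwards [measure_eq_zero_iff_ae_notMem.1 hm] with x hx
      simpa using hx)
  have r2 : ∀ m : Measure ℝ, m (Set.Ioi 0) = 0 → m.restrict (Set.Iic 0) = m := fun m hm =>
    Measure.restrict_eq_self_of_ae_mem (by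
      filter_upwards [measure_eq_zero_iff_ae_notMem.1 hm] with x hx
      simpa using hx)
  constructor
  · have := congrArg (fun m => m.restrict (Set.Ioi 0)) h
    simpa [r1 a ha, r1 a' ha', Measure.restrict_eq_zero.2 hb, Measure.restrict_eq_zero.2 hb']
      using this
  · have := congrArg (fun m => m.restrict (Set.Iic 0)) h
    simpa [r2 b hb, r2 b' hb', Measure.restrict_eq_zero.2 ha, Measure.restrict_eq_zero.2 ha']
      using this

lemma charFun_add_measure (a b : Measure ℝ) [IsFiniteMeasure a] [IsFiniteMeasure b] (t : ℝ) :
    charFun (a + b) t = charFun a t + charFun b t := by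
  have hi : ∀ m : Measure ℝ, IsFiniteMeasure m →
      Integrable (fun x : ℝ => Complex.exp (t * x * Complex.I)) m := by
    intro m _
    refine Integrable.of_bound (by fun_prop) 1 (.of_forall fun x => ?_)
    rw [← Complex.ofReal_mul, Complex.norm_exp_ofReal_mul_I]
  simp only [charFun_apply_real]
  exact integral_add_measure (hi a inferInstance) (hi b inferInstance)

lemma charFun_sum_measure {ι : Type*} (s : Finset ι) (a : ι → Measure ℝ)
    [∀ i, IsFiniteMeasure (a i)] (t : ℝ) :
    charFun (∑ i ∈ s, a i) t = ∑ i ∈ s, charFun (a i) t := by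
  classical
  induction s using Finset.induction_on with
  | empty => simp
  | insert i s hi ih => rw [Finset.sum_insert hi, charFun_add_measure, ih, Finset.sum_insert hi]

lemma charFun_restrict_Ioi_add_restrict_Iic (a : Measure ℝ) [IsFiniteMeasure a] (t : ℝ) :
    charFun (a.restrict (Set.Ioi 0)) t + charFun (a.restrict (Set.Iic 0)) t = charFun a t := by
  rw [← charFun_add_measure, ← Set.compl_Ioi, Measure.restrict_add_restrict_compl measurableSet_Ioi]

/-- Wiener–Hopf uniqueness: a sequence of measures with generating function `∑ z ^ n (a n)`, carried
by the positive half-line, and one carried by the nonpositive half-line are determined by the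
product of the generating functions. -/
lemma eq_of_sum_charFun_mul_eq {a b a' b' : ℕ → Measure ℝ} [∀ n, IsFiniteMeasure (a n)]
    [∀ n, IsFiniteMeasure (b n)] [∀ n, IsFiniteMeasure (a' n)] [∀ n, IsFiniteMeasure (b' n)]
    (ha0 : a 0 = Measure.dirac 0) (hb0 : b 0 = Measure.dirac 0)
    (ha'0 : a' 0 = Measure.dirac 0) (hb'0 : b' 0 = Measure.dirac 0)
    (ha : ∀ n, a (n + 1) (Set.Iic 0) = 0) (ha' : ∀ n, a' (n + 1) (Set.Iic 0) = 0)
    (hb : ∀ n, b n (Set.Ioi 0) = 0) (hb' : ∀ n, b' n (Set.Ioi 0) = 0)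
    (h : ∀ n t, ∑ p ∈ antidiagonal n, charFun (a p.1) t * charFun (b p.2) t
      = ∑ p ∈ antidiagonal n, charFun (a' p.1) t * charFun (b' p.2) t) (n : ℕ) :
    a n = a' n ∧ b n = b' n := by
  induction n using Nat.strong_induction_on with
  | _ n ih =>
    cases n with
    | zero => exact ⟨ha0.trans ha'0.symm, hb0.trans hb'0.symm⟩
    | succ n =>
      refine eq_of_add_eq_add (ha n) (ha' n) (hb _) (hb' _)
        (Measure.ext_of_charFun (funext fun t => ?_))
      have := h (n + 1) t
      -- Only the two extreme terms involve index `n + 1` of either sequence. The inner terms agree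
      -- by induction, leaving `a (n + 1) + b (n + 1)` determined.
      rw [Finset.Nat.sum_antidiagonal_eq_sum_range_succ
          (fun i j => charFun (a i) t * charFun (b j) t),
        Finset.Nat.sum_antidiagonal_eq_sum_range_succ
          (fun i j => charFun (a' i) t * charFun (b' j) t),
        Finset.sum_range_succ, Finset.sum_range_succ', Finset.sum_range_succ,
        Finset.sum_range_succ' (fun k => charFun (a' k) t * charFun (b' (n + 1 - k)) t)] at this
      have e : ∑ k ∈ Finset.range n, charFun (a (k + 1)) t * charFun (b (n + 1 - (k + 1))) t
          = ∑ k ∈ Finset.range n, charFun (a' (k + 1)) t * charFun (b' (n + 1 - (k + 1))) t := by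
        refine Finset.sum_congr rfl fun k hk => ?_
        have := Finset.mem_range.1 hk
        rw [(ih (k + 1) (by omega)).1, (ih (n + 1 - (k + 1)) (by omega)).2]
      simp only [e, ha0, hb0, ha'0, hb'0, Nat.sub_zero, Nat.sub_self, charFun_dirac,
        inner_zero_left, Complex.ofReal_zero, zero_mul, Complex.exp_zero, one_mul, mul_one] at this
      rw [charFun_add_measure, charFun_add_measure]
      linear_combination this

/-- The measures `a n` with `a 0 = δ₀` and `(n + 1) a (n + 1) = ∑ p j ∗ a (n - j)`; formally
`∑ z ^ n (a n)` is the exponential of `∑ z ^ (n + 1) (p n) / (n + 1)`. -/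
noncomputable def expSeq (p : ℕ → Measure ℝ) : ℕ → Measure ℝ
  | 0 => Measure.dirac 0
  | n + 1 => ((n : ℝ≥0∞) + 1)⁻¹ • ∑ j : Fin (n + 1), p j ∗ expSeq p (n - j)

lemma expSeq_zero (p : ℕ → Measure ℝ) : expSeq p 0 = Measure.dirac 0 := by rw [expSeq]

lemma expSeq_succ (p : ℕ → Measure ℝ) (n : ℕ) : expSeq p (n + 1)
    = ((n : ℝ≥0∞) + 1)⁻¹ • ∑ j ∈ Finset.range (n + 1), p j ∗ expSeq p (n - j) := by
  rw [expSeq, Finset.sum_range fun j => p j ∗ expSeq p (n - j)]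

instance isFiniteMeasure_expSeq (p : ℕ → Measure ℝ) [∀ n, IsFiniteMeasure (p n)] (n : ℕ) :
    IsFiniteMeasure (expSeq p n) := by
  induction n using Nat.strong_induction_on with
  | _ n ih =>
    cases n with
    | zero => rw [expSeq_zero]; infer_instance
    | succ n =>
      have (j : ℕ) : IsFiniteMeasure (p j ∗ expSeq p (n - j)) := by
        have := ih (n - j) (by omega)
        infer_instance
      rw [expSeq_succ]
      exact Measure.smul_finite _ (by simp)

lemma charFun_expSeq_succ (p : ℕ → Measure ℝ) [∀ n, IsFiniteMeasure (p n)] (n : ℕ) (t : ℝ) :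
    ((n : ℂ) + 1) * charFun (expSeq p (n + 1)) t
      = ∑ j ∈ Finset.range (n + 1), charFun (p j) t * charFun (expSeq p (n - j)) t := by
  have h0 : (n : ℂ) + 1 ≠ 0 := by exact_mod_cast Nat.succ_ne_zero n
  have h1 : charFun (expSeq p (n + 1)) t
      = ((n : ℂ) + 1)⁻¹ * charFun (∑ j ∈ Finset.range (n + 1), p j ∗ expSeq p (n - j)) t := by
    rw [expSeq_succ, charFun_apply, integral_smul_measure, ← charFun_apply, ENNReal.toReal_inv,
      ENNReal.toReal_add (by simp) (by simp), Complex.real_smul]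
    simp
  rw [h1, mul_inv_cancel_left₀ h0, charFun_sum_measure]
  exact Finset.sum_congr rfl fun j _ => charFun_conv t

/-- If `x + y ≤ 0`, then `x ≤ 0` or `y < 0`. The second factor may have an atom at `0`, as needed
for `expSeq p 0 = δ₀`. -/
lemma conv_Iic_eq_zero {a b : Measure ℝ} [IsFiniteMeasure a] [IsFiniteMeasure b]
    (ha : a (Set.Iic 0) = 0) (hb : b (Set.Iio 0) = 0) : (a ∗ b) (Set.Iic 0) = 0 := by
  rw [Measure.conv, Measure.map_apply (by fun_prop) measurableSet_Iic]
  refine measure_mono_null (t := Set.Iic 0 ×ˢ Set.univ ∪ Set.univ ×ˢ Set.Iio 0) ?_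
    (measure_union_null (by simp [Measure.prod_prod, ha]) (by simp [Measure.prod_prod, hb]))
  rintro ⟨x, y⟩ h
  simp only [Set.mem_preimage, Set.mem_Iic, Set.mem_union, Set.mem_prod, Set.mem_univ, and_true,
    Set.mem_Iio, true_and] at h ⊢
  by_contra! hc
  linarith [hc.1, hc.2]

lemma conv_Ioi_eq_zero {a b : Measure ℝ} [IsFiniteMeasure a] [IsFiniteMeasure b]
    (ha : a (Set.Ioi 0) = 0) (hb : b (Set.Ioi 0) = 0) : (a ∗ b) (Set.Ioi 0) = 0 := by
  rw [Measure.conv, Measure.map_apply (by fun_prop) measurableSet_Ioi]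
  refine measure_mono_null (t := Set.Ioi 0 ×ˢ Set.univ ∪ Set.univ ×ˢ Set.Ioi 0) ?_
    (measure_union_null (by simp [Measure.prod_prod, ha]) (by simp [Measure.prod_prod, hb]))
  rintro ⟨x, y⟩ h
  simp only [Set.mem_preimage, Set.mem_Ioi, Set.mem_union, Set.mem_prod, Set.mem_univ, and_true,
    true_and] at h ⊢
  by_contra! hc
  linarith [hc.1, hc.2]

lemma expSeq_succ_Iic {p : ℕ → Measure ℝ} [∀ n, IsFiniteMeasure (p n)]
    (hp : ∀ n, p n (Set.Iic 0) = 0) (n : ℕ) : expSeq p (n + 1) (Set.Iic 0) = 0 := by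
  induction n using Nat.strong_induction_on with
  | _ n ih =>
    rw [expSeq_succ, Measure.smul_apply, Measure.finsetSum_apply, Finset.sum_eq_zero, smul_zero]
    intro j hj
    refine conv_Iic_eq_zero (hp j) ?_
    cases h : n - j with
    | zero => simp [expSeq_zero]
    | succ m => exact measure_mono_null Set.Iio_subset_Iic_self (ih m (by omega))

lemma expSeq_Ioi {p : ℕ → Measure ℝ} [∀ n, IsFiniteMeasure (p n)]
    (hp : ∀ n, p n (Set.Ioi 0) = 0) (n : ℕ) : expSeq p n (Set.Ioi 0) = 0 := by
  induction n using Nat.strong_induction_on with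
  | _ n ih =>
    cases n with
    | zero => simp [expSeq_zero]
    | succ n =>
      rw [expSeq_succ, Measure.smul_apply, Measure.finsetSum_apply, Finset.sum_eq_zero, smul_zero]
      exact fun j hj => conv_Ioi_eq_zero (hp j) (ih (n - j) (by omega))

/-- The product of the two exponential generating functions belonging to `π` and `ν` is the
geometric series `φ` if `π j + ν j = φ (j + 1)`. -/
lemma sum_antidiagonal_mul_of_recursion {α β π ν φ : ℕ → ℂ}
    (hφ : ∀ j m, φ (j + m) = φ j * φ m) (hφ0 : φ 0 = 1) (hα0 : α 0 = 1) (hβ0 : β 0 = 1)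
    (hα : ∀ n : ℕ, ((n : ℂ) + 1) * α (n + 1) = ∑ p ∈ antidiagonal n, π p.1 * α p.2)
    (hβ : ∀ n : ℕ, ((n : ℂ) + 1) * β (n + 1) = ∑ p ∈ antidiagonal n, ν p.1 * β p.2)
    (hπν : ∀ j, π j + ν j = φ (j + 1)) (n : ℕ) :
    ∑ p ∈ antidiagonal n, α p.1 * β p.2 = φ n := by
  -- Associativity of convolution, read off from multiplication of formal power series.
  have assoc : ∀ (f g h : ℕ → ℂ) (n : ℕ),
      ∑ p ∈ antidiagonal n, (∑ r ∈ antidiagonal p.1, f r.1 * g r.2) * h p.2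
        = ∑ p ∈ antidiagonal n, f p.1 * ∑ r ∈ antidiagonal p.2, g r.1 * h r.2 := by
    intro f g h n
    have := congrArg (PowerSeries.coeff n)
      (mul_assoc (PowerSeries.mk f) (PowerSeries.mk g) (PowerSeries.mk h))
    simpa only [PowerSeries.coeff_mul, PowerSeries.coeff_mk] using this
  induction n using Nat.strong_induction_on with
  | _ n ih =>
    cases n with
    | zero => simp [hα0, hβ0, hφ0]
    | succ n =>
      have h0 : (n : ℂ) + 1 ≠ 0 := by exact_mod_cast Nat.succ_ne_zero n
      have ih' : ∀ p ∈ antidiagonal n, ∑ r ∈ antidiagonal p.2, α r.1 * β r.2 = φ p.2 := by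
        intro p hp
        have := mem_antidiagonal.1 hp
        exact ih _ (by omega)
      -- This and `e2` are the two halves of the product rule for the Cauchy product of `α` and `β`.
      -- The weight removes the index-zero term, the recursion rewrites the rest, and induction
      -- replaces the product of `α` and `β` by `φ`.
      have e1 : ∑ p ∈ antidiagonal (n + 1), (p.1 : ℂ) * (α p.1 * β p.2)
          = ∑ p ∈ antidiagonal n, π p.1 * φ p.2 := by
        rw [Finset.Nat.sum_antidiagonal_succ, Nat.cast_zero, zero_mul, zero_add]
        calc _ = ∑ p ∈ antidiagonal n, (∑ r ∈ antidiagonal p.1, π r.1 * α r.2) * β p.2 :=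
              Finset.sum_congr rfl fun p _ => by rw [← hα]; push_cast; ring
          _ = _ := by
              rw [assoc]
              exact Finset.sum_congr rfl fun p hp => by rw [ih' p hp]
      have e2 : ∑ p ∈ antidiagonal (n + 1), (p.2 : ℂ) * (α p.1 * β p.2)
          = ∑ p ∈ antidiagonal n, ν p.1 * φ p.2 := by
        rw [← Finset.Nat.sum_antidiagonal_swap, Finset.Nat.sum_antidiagonal_succ]
        simp only [Prod.fst_swap, Prod.snd_swap]
        rw [Nat.cast_zero, zero_mul, zero_add]
        calc _ = ∑ p ∈ antidiagonal n, (∑ r ∈ antidiagonal p.1, ν r.1 * β r.2) * α p.2 :=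
              Finset.sum_congr rfl fun p _ => by rw [← hβ]; push_cast; ring
          _ = _ := by
              rw [assoc]
              refine Finset.sum_congr rfl fun p hp => ?_
              rw [← ih' p hp, ← Finset.Nat.sum_antidiagonal_swap]
              simp only [Prod.fst_swap, Prod.snd_swap, mul_comm]
      refine mul_left_cancel₀ h0 ?_
      calc ((n : ℂ) + 1) * ∑ p ∈ antidiagonal (n + 1), α p.1 * β p.2
          = ∑ p ∈ antidiagonal (n + 1), (p.1 : ℂ) * (α p.1 * β p.2)
            + ∑ p ∈ antidiagonal (n + 1), (p.2 : ℂ) * (α p.1 * β p.2) := by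
            rw [Finset.mul_sum, ← Finset.sum_add_distrib]
            refine Finset.sum_congr rfl fun p hp => ?_
            have : (p.1 : ℂ) + p.2 = n + 1 := by exact_mod_cast mem_antidiagonal.1 hp
            rw [← this]
            ring
        _ = ∑ p ∈ antidiagonal n, φ (n + 1) := by
            rw [e1, e2, ← Finset.sum_add_distrib]
            refine Finset.sum_congr rfl fun p hp => ?_
            rw [← add_mul, hπν, ← hφ, ← mem_antidiagonal.1 hp]
            congr 1
            omega
        _ = ((n : ℂ) + 1) * φ (n + 1) := by
            rw [Finset.sum_const, Finset.Nat.card_antidiagonal, nsmul_eq_mul]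
            push_cast
            ring

/-- Spitzer's identity, in the form of its recursion: the laws of the walk at its strict ascending
ladder times, and while it is nonpositive. -/
lemma ladderLaw_eq_expSeq (μ : Measure ℝ) [IsProbabilityMeasure μ] (n : ℕ) :
    ladderLaw μ n = expSeq (fun j => (walkLaw μ (j + 1)).restrict (Set.Ioi 0)) n ∧
    belowLaw μ n = expSeq (fun j => (walkLaw μ (j + 1)).restrict (Set.Iic 0)) n := by
  have f1 (n : ℕ) : IsFiniteMeasure (ladderLaw μ n) :=
    ⟨(ladderLaw_univ_le μ n).trans_lt ENNReal.one_lt_top⟩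
  have f2 (n : ℕ) : IsFiniteMeasure (belowLaw μ n) :=
    ⟨(belowLaw_univ_le μ n).trans_lt ENNReal.one_lt_top⟩
  refine eq_of_sum_charFun_mul_eq (ladderLaw_zero μ) (belowLaw_zero μ) (expSeq_zero _)
    (expSeq_zero _) (ladderLaw_succ_Iic μ)
    (expSeq_succ_Iic fun n => ?_) (belowLaw_Ioi μ) (expSeq_Ioi fun n => ?_) (fun n t => ?_) n
  · rw [Measure.restrict_apply measurableSet_Iic, Set.Iic_inter_Ioi, Set.Ioc_self, measure_empty]
  · rw [Measure.restrict_apply measurableSet_Ioi, Set.Ioi_inter_Iic, Set.Ioc_self, measure_empty]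
  · rw [sum_ladderLaw_mul_belowLaw]
    refine (sum_antidiagonal_mul_of_recursion (φ := fun n => charFun (walkLaw μ n) t)
      (α := fun n => charFun (expSeq _ n) t) (β := fun n => charFun (expSeq _ n) t)
      (π := fun j => charFun ((walkLaw μ (j + 1)).restrict (Set.Ioi 0)) t)
      (ν := fun j => charFun ((walkLaw μ (j + 1)).restrict (Set.Iic 0)) t)
      (fun j m => charFun_walkLaw_add μ j m t) ?_ ?_ ?_ (fun n => ?_) (fun n => ?_)
      (fun j => charFun_restrict_Ioi_add_restrict_Iic _ t) n).symm
    · simp [charFun_walkLaw, walk_zero]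
    · simp [expSeq_zero]
    · simp [expSeq_zero]
    · rw [charFun_expSeq_succ, Finset.Nat.sum_antidiagonal_eq_sum_range_succ
        fun i j => charFun ((walkLaw μ (i + 1)).restrict (Set.Ioi 0)) t * charFun (expSeq
          (fun j => (walkLaw μ (j + 1)).restrict (Set.Ioi 0)) j) t]
    · rw [charFun_expSeq_succ, Finset.Nat.sum_antidiagonal_eq_sum_range_succ
        fun i j => charFun ((walkLaw μ (i + 1)).restrict (Set.Iic 0)) t * charFun (expSeq
          (fun j => (walkLaw μ (j + 1)).restrict (Set.Iic 0)) j) t]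

end Factorisation

end RandomWalk

namespace RandomWalk

/-! ### The walk up to an independent geometric time -/

section GeometricTime

variable (μ : Measure ℝ) [IsProbabilityMeasure μ]

lemma walkLaw_add (k m : ℕ) : (iidLaw μ).map (fun x => walk x (k + m) - walk x k) = walkLaw μ m := by
  have : (fun x => walk x (k + m) - walk x k) = (fun x => walk x m) ∘ shift k := by
    funext x
    simp [walk_add]
  rw [this, ← Measure.map_map (by fun_prop) (by fun_prop), map_shift_iidLaw, walkLaw]

/-- The first increment is independent of the sum of the others. With that sum fixed at `y`, the
first increment must equal `-y`, which has probability zero; Fubini concludes. -/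
lemma walkLaw_succ_singleton_zero (hμ : ∀ y, μ {y} = 0) (d : ℕ) :
    walkLaw μ (d + 1) {0} = 0 := by
  have hlaw : (iidLaw μ).map (fun x => (walk x 1, walk x (1 + d) - walk x 1))
      = (walkLaw μ 1).prod (walkLaw μ d) := by
    have := (indepFun_trunc_shift μ 1).comp (measurable_walk 1) (measurable_walk d)
    have e : ((fun x => walk x 1) ∘ trunc 1) = fun x => walk x 1 :=
      funext fun x => walk_trunc x le_rfl
    have e' : ((fun x => walk x d) ∘ shift 1) = fun x => walk x (1 + d) - walk x 1 :=
      funext fun x => by simp [walk_add]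
    rw [e, e'] at this
    rw [this.map_prod_eq_prod_map_map (by fun_prop) (by fun_prop), walkLaw_add]
    rfl
  have h1 : walkLaw μ 1 = μ := by
    have : (fun x : ℕ → ℝ => walk x 1) = fun x => x 0 := by
      funext x
      simp [walk]
    rw [walkLaw, this]
    exact Measure.infinitePi_map_eval (fun _ : ℕ => μ) 0
  have hm : MeasurableSet {p : ℝ × ℝ | p.1 + p.2 = 0} :=
    measurableSet_eq_fun (by fun_prop) (by fun_prop)
  have h2 : walkLaw μ (d + 1) {0}
      = (iidLaw μ).map (fun x => (walk x 1, walk x (1 + d) - walk x 1))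
        {p : ℝ × ℝ | p.1 + p.2 = 0} := by
    rw [walkLaw, Measure.map_apply (by fun_prop) (measurableSet_singleton 0),
      Measure.map_apply (by fun_prop) hm]
    congr 1
    ext x
    simp [add_comm]
  rw [h2, hlaw, h1, Measure.prod_apply_symm hm, lintegral_eq_zero_of_ae_eq_zero]
  refine .of_forall fun y => ?_
  have : (fun x => (x, y)) ⁻¹' {p : ℝ × ℝ | p.1 + p.2 = 0} = {-y} := by
    ext x
    simp [eq_neg_iff_add_eq_zero]
  simp only [this, hμ, Pi.zero_apply]

lemma ae_walk_injective (hμ : ∀ y, μ {y} = 0) :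
    ∀ᵐ x ∂iidLaw μ, ∀ i j : ℕ, walk x i = walk x j → i = j := by
  have h : ∀ᵐ x ∂iidLaw μ, ∀ i d : ℕ, walk x (i + (d + 1)) - walk x i ≠ 0 := by
    rw [ae_all_iff]
    intro i
    rw [ae_all_iff]
    intro d
    have := walkLaw_succ_singleton_zero μ hμ d
    rw [← walkLaw_add μ i (d + 1), Measure.map_apply (by fun_prop) (measurableSet_singleton 0)] at this
    exact measure_eq_zero_iff_ae_notMem.1 this
  filter_upwards [h] with x hx i j hij
  rcases lt_trichotomy i j with hlt | h' | hlt
  · obtain ⟨d, rfl⟩ := Nat.exists_eq_add_of_lt hlt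
    exact absurd (sub_eq_zero.2 hij.symm) (hx i d)
  · exact h'
  · obtain ⟨d, rfl⟩ := Nat.exists_eq_add_of_lt hlt
    exact absurd (sub_eq_zero.2 hij) (hx j d)

/-- The law of the walk at its strict ascending ladder times, weighted by `q ^ k`. -/
noncomputable def ladderMeasure (q : ℝ) : Measure (ℝ × ℝ) :=
  layers (fun n => q ^ n) (fun n => n) (ladderLaw μ)

/-- The law of the walk while it is nonpositive, weighted by `q ^ m`. -/
noncomputable def belowMeasure (q : ℝ) : Measure (ℝ × ℝ) :=
  layers (fun n => q ^ n) (fun n => n) (belowLaw μ)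

lemma layers_apply (c v : ℕ → ℝ) (a : ℕ → Measure ℝ) {U : Set (ℝ × ℝ)} (hU : MeasurableSet U) :
    layers c v a U = ∑' n, ENNReal.ofReal (c n) * a n ((fun x => (v n, x)) ⁻¹' U) := by
  rw [layers, Measure.sum_apply _ hU]
  refine tsum_congr fun n => ?_
  rw [Measure.smul_apply, Measure.map_apply (by fun_prop) hU, smul_eq_mul]

variable {Ω : Type*} [MeasurableSpace Ω] {P : Measure Ω} [IsProbabilityMeasure P]

lemma measure_eq_of_measure_le_eq {N : Ω → ℕ} (hN : Measurable N) {q : ℝ} (hq0 : 0 ≤ q)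
    (hgeom : ∀ n : ℕ, P {ω | n ≤ N ω} = ENNReal.ofReal (q ^ n)) (n : ℕ) :
    P (N ⁻¹' {n}) = ENNReal.ofReal (1 - q) * ENNReal.ofReal (q ^ n) := by
  have hset : N ⁻¹' {n} = {ω | n ≤ N ω} \ {ω | n + 1 ≤ N ω} := by
    ext ω
    simp only [Set.mem_preimage, Set.mem_singleton_iff, Set.mem_sdiff, Set.mem_ofPred_eq]
    omega
  have hm : MeasurableSet {ω | n + 1 ≤ N ω} := measurableSet_le measurable_const hN
  have hsub : {ω | n + 1 ≤ N ω} ⊆ {ω | n ≤ N ω} := by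
    intro ω hω
    simp only [Set.mem_ofPred_eq] at hω ⊢
    omega
  rw [hset, measure_sdiff hsub hm.nullMeasurableSet (measure_ne_top _ _), hgeom, hgeom,
    ← ENNReal.ofReal_sub _ (by positivity), ← ENNReal.ofReal_mul' (by positivity)]
  congr 1
  ring

variable {X : Ω → ℕ → ℝ} {N : Ω → ℕ} {q : ℝ}

lemma measurable_argMax_walk (hX : Measurable X) (hN : Measurable N) :
    Measurable fun ω => argMax (walk (X ω)) (N ω) := by
  have h : Measurable fun p : ℕ × (ℕ → ℝ) => argMax (walk p.2) p.1 := by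
    refine measurable_from_prod_countable_right fun n => measurable_to_countable' fun k => ?_
    rcases le_or_gt k n with hk | hk
    · obtain ⟨m, rfl⟩ := Nat.exists_eq_add_of_le hk
      exact measurableSet_maxAt_add k m
    · convert MeasurableSet.empty
      ext x
      simp only [Set.mem_preimage, Set.mem_singleton_iff, Set.mem_empty_iff_false, iff_false]
      have := (argMax_spec (walk x) n).1
      omega
  exact h.comp (hN.prodMk hX)

lemma measurable_walk_random (hX : Measurable X) (hN : Measurable N) :
    Measurable fun ω => walk (X ω) (N ω) := by
  have h : Measurable fun p : ℕ × (ℕ → ℝ) => walk p.2 p.1 :=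
    measurable_from_prod_countable_right fun n => measurable_walk n
  exact h.comp (hN.prodMk hX)

/-- The joint law of the pairs before and after the maximum. -/
lemma measure_pre_inter_post (hX : Measurable X) (hXlaw : P.map X = iidLaw μ)
    (hN : Measurable N) (hXN : IndepFun X N P) (hq0 : 0 ≤ q)
    (hgeom : ∀ n : ℕ, P {ω | n ≤ N ω} = ENNReal.ofReal (q ^ n)) {L : Ω → ℕ}
    (hL : ∀ ω, L ω = argMax (walk (X ω)) (N ω)) {U V : Set (ℝ × ℝ)} (hU : MeasurableSet U)
    (hV : MeasurableSet V) :
    P {ω | ((L ω : ℝ), walk (X ω) (L ω)) ∈ U ∧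
        ((N ω : ℝ) - L ω, walk (X ω) (N ω) - walk (X ω) (L ω)) ∈ V}
      = ENNReal.ofReal (1 - q) * (ladderMeasure μ q U * belowMeasure μ q V) := by
  set W := {ω | ((L ω : ℝ), walk (X ω) (L ω)) ∈ U ∧
        ((N ω : ℝ) - L ω, walk (X ω) (N ω) - walk (X ω) (L ω)) ∈ V}
  have hLm : Measurable L := by
    rw [funext hL]
    exact measurable_argMax_walk hX hN
  have hLN : ∀ ω, L ω ≤ N ω := fun ω => hL ω ▸ (argMax_spec _ _).1
  have hT : Measurable fun ω => (L ω, N ω - L ω) :=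
    hLm.prodMk (hN.sub hLm)
  -- The event is split according to the countably many values `(k, m)` of `(L, N - L)`.
  have hsum := tsum_measure_preimage_singleton (μ := P.restrict W) (s := Set.univ)
    Set.countable_univ (f := fun ω => (L ω, N ω - L ω))
    fun y _ => hT (measurableSet_singleton y)
  rw [tsum_univ fun y => P.restrict W ((fun ω => (L ω, N ω - L ω)) ⁻¹' {y}), Set.preimage_univ,
    Measure.restrict_apply_univ] at hsum
  rw [← hsum, ladderMeasure, belowMeasure, layers_apply _ _ _ hU, layers_apply _ _ _ hV,
    ENNReal.tsum_prod', ← ENNReal.tsum_mul_right, ← ENNReal.tsum_mul_left]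
  refine tsum_congr fun k => ?_
  rw [← ENNReal.tsum_mul_left, ← ENNReal.tsum_mul_left]
  refine tsum_congr fun m => ?_
  have hU' : MeasurableSet ((fun x : ℝ => ((k : ℝ), x)) ⁻¹' U) :=
    (by fun_prop : Measurable fun x : ℝ => ((k : ℝ), x)) hU
  have hV' : MeasurableSet ((fun x : ℝ => ((m : ℝ), x)) ⁻¹' V) :=
    (by fun_prop : Measurable fun x : ℝ => ((m : ℝ), x)) hV
  set T : Set (ℕ → ℝ) := {x | x ∈ maxAt (k + m) k ∧ walk x k ∈ (fun x : ℝ => ((k : ℝ), x)) ⁻¹' U ∧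
    walk x (k + m) - walk x k ∈ (fun x : ℝ => ((m : ℝ), x)) ⁻¹' V} with hT_def
  have hTm : MeasurableSet T := by
    have h1 := (measurable_walk k) hU'
    have h2 : MeasurableSet ((fun x : ℕ → ℝ => walk x (k + m) - walk x k) ⁻¹'
      ((fun x : ℝ => ((m : ℝ), x)) ⁻¹' V)) :=
      (by fun_prop : Measurable fun x : ℕ → ℝ => walk x (k + m) - walk x k) hV'
    exact (measurableSet_maxAt_add k m).inter (h1.inter h2)
  have hset : (fun ω => (L ω, N ω - L ω)) ⁻¹' {(k, m)} ∩ W = X ⁻¹' T ∩ N ⁻¹' {k + m} := by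
    ext ω
    have h1 := hLN ω
    have h2 := hL ω
    simp only [Set.mem_inter_iff, Set.mem_preimage, Set.mem_singleton_iff, Prod.mk.injEq, W, T,
      Set.mem_ofPred_eq, maxAt]
    constructor
    · rintro ⟨⟨rfl, h4⟩, h5, h6⟩
      have h7 : N ω = L ω + m := by omega
      have h8 : (N ω : ℝ) - L ω = m := by rw [h7]; push_cast; ring
      rw [h8, h7] at h6
      rw [h7] at h2
      exact ⟨⟨h2.symm, h5, h6⟩, h7⟩
    · rintro ⟨⟨h3, h5, h6⟩, h7⟩
      rw [h7, h3] at h2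
      have h8 : (N ω : ℝ) - L ω = m := by rw [h7, h2]; push_cast; ring
      rw [h8, h7, h2]
      exact ⟨⟨rfl, by omega⟩, h5, h6⟩
  -- Here the geometric law is decisive: `q ^ (k + m)` splits into `q ^ k` and `q ^ m`, so each
  -- summand is a product of a term in `k` and a term in `m`.
  rw [Measure.restrict_apply (hT (measurableSet_singleton _)), hset,
    hXN.measure_inter_preimage_eq_mul _ _ hTm (measurableSet_singleton _),
    ← Measure.map_apply hX hTm, hXlaw, hT_def, measure_maxAt_eq_mul μ k m hU' hV',
    measure_eq_of_measure_le_eq hN hq0 hgeom, pow_add, ENNReal.ofReal_mul (by positivity)]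
  ring

/-- The constant need not be known: at `l = 0` the characteristic function of a probability measure
is `1`, which forces `c = exp (-ν(E))`. -/
lemma isCompoundPoisson_of_map_eq_smul {α ν : Measure (ℝ × ℝ)} [IsFiniteMeasure α]
    [IsFiniteMeasure ν] {Y : Ω → ℝ × ℝ} (hY : Measurable Y) {c : ℝ≥0∞} (hlaw : P.map Y = c • α)
    (hα : ∀ l, charFunDual α l = Complex.exp (charFunDual ν l)) :
    IsCompoundPoisson (P.map Y) ν := by
  have := Measure.isProbabilityMeasure_map (μ := P) hY.aemeasurable
  have hc : ∀ l, charFunDual (P.map Y) l = c.toReal * Complex.exp (charFunDual ν l) := by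
    intro l
    rw [hlaw, charFunDual_apply, integral_smul_measure, ← charFunDual_apply, hα, Complex.real_smul]
  refine isCompoundPoisson_of_charFunDual fun l => ?_
  have h0 := hc 0
  simp only [charFunDual_apply, zero_apply, Complex.ofReal_zero, zero_mul,
    Complex.exp_zero, integral_const, probReal_univ, one_smul, Complex.real_smul, mul_one] at h0
  rw [hc, sub_eq_add_neg, Complex.exp_add, mul_comm, Complex.exp_neg]
  congr 1
  exact eq_inv_of_mul_eq_one_left h0.symm

lemma walkLaw_restrict_univ_le (A : Set ℝ) (n : ℕ) :
    (walkLaw μ n).restrict A Set.univ ≤ 1 :=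
  (Measure.restrict_apply_le _ _).trans prob_le_one

/-- The measure `j⁻¹ q ^ j P (S_j ∈ dx)` on `{1, 2, …} × A`. -/
noncomputable def jumpMeasure (q : ℝ) (A : Set ℝ) : Measure (ℝ × ℝ) :=
  layers (fun n => q ^ (n + 1) / ((n : ℝ) + 1)) (fun n => (n : ℝ) + 1)
    fun n => (walkLaw μ (n + 1)).restrict A

lemma charFunDual_ladderMeasure (hq0 : 0 ≤ q) (hq1 : q < 1) :
    IsFiniteMeasure (ladderMeasure μ q) ∧ IsFiniteMeasure (jumpMeasure μ q (Set.Ioi 0)) ∧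
    ∀ l, charFunDual (ladderMeasure μ q) l
      = Complex.exp (charFunDual (jumpMeasure μ q (Set.Ioi 0)) l) := by
  refine charFunDual_layers_eq_exp (ladderLaw_univ_le μ)
    (fun n => walkLaw_restrict_univ_le μ _ (n + 1)) (ladderLaw_zero μ) (fun t n => ?_) hq0 hq1
  simp only [(ladderLaw_eq_expSeq μ _).1]
  exact charFun_expSeq_succ _ n t

lemma charFunDual_belowMeasure (hq0 : 0 ≤ q) (hq1 : q < 1) :
    IsFiniteMeasure (belowMeasure μ q) ∧ IsFiniteMeasure (jumpMeasure μ q (Set.Iic 0)) ∧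
    ∀ l, charFunDual (belowMeasure μ q) l
      = Complex.exp (charFunDual (jumpMeasure μ q (Set.Iic 0)) l) := by
  refine charFunDual_layers_eq_exp (belowLaw_univ_le μ)
    (fun n => walkLaw_restrict_univ_le μ _ (n + 1)) (belowLaw_zero μ) (fun t n => ?_) hq0 hq1
  simp only [(ladderLaw_eq_expSeq μ _).2]
  exact charFun_expSeq_succ _ n t

omit [IsProbabilityMeasure μ] [IsProbabilityMeasure P] in
lemma faceIntensity_eq_jumpMeasure {X : ℕ → Ω → ℝ} (hX : Measurable fun ω i => X i ω)
    (hXlaw : P.map (fun ω i => X i ω) = iidLaw μ) (A : Set ℝ) :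
    faceIntensity P X q A = jumpMeasure μ q A := by
  rw [faceIntensity, jumpMeasure, layers]
  congr 1
  funext n
  rw [walkLaw, ← hXlaw, Measure.map_map (by fun_prop) hX]
  rfl

end GeometricTime

end RandomWalk

/-! ### Transfer to the given probability space and the theorem -/

lemma RandomWalk.map_eq_iidLaw {Ω : Type*} [MeasurableSpace Ω] {P : Measure Ω}
    {X : ℕ → Ω → ℝ} (hXmeas : ∀ i, Measurable (X i)) (hXindep : iIndepFun X P)
    (hXident : ∀ i, IdentDistrib (X i) (X 0) P P) :
    P.map (fun ω i => X i ω) = iidLaw (P.map (X 0)) := by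
  rw [hXindep.map_fun_eq_infinitePi_map hXmeas, funext fun i => (hXident i).map_eq]

lemma RandomWalk.ae_walk_injective_of_iIndepFun {Ω : Type*} [MeasurableSpace Ω] {P : Measure Ω}
    [IsProbabilityMeasure P]
    {X : ℕ → Ω → ℝ} (hXmeas : ∀ i, Measurable (X i)) (hXindep : iIndepFun X P)
    (hXident : ∀ i, IdentDistrib (X i) (X 0) P P) (hXcont : ∀ x : ℝ, P {ω | X 0 ω = x} = 0) :
    ∀ᵐ ω ∂P, ∀ i j : ℕ, walk (fun i => X i ω) i = walk (fun i => X i ω) j → i = j := by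
  have := Measure.isProbabilityMeasure_map (μ := P) (hXmeas 0).aemeasurable
  have hX : Measurable fun ω i => X i ω := measurable_pi_lambda _ hXmeas
  have h := ae_walk_injective (P.map (X 0)) fun y => by
    rw [Measure.map_apply (hXmeas 0) (measurableSet_singleton y)]
    exact hXcont y
  rw [← map_eq_iidLaw hXmeas hXindep hXident] at h
  exact ae_of_ae_map hX.aemeasurable h

theorem mainTheorem6 {Ω : Type*} [MeasurableSpace Ω] (P : Measure Ω) [IsProbabilityMeasure P]
    (X : ℕ → Ω → ℝ) (hXmeas : ∀ i, Measurable (X i)) (hXindep : iIndepFun X P)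
    (hXident : ∀ i, IdentDistrib (X i) (X 0) P P) (hXcont : ∀ x : ℝ, P {ω | X 0 ω = x} = 0)
    (q : ℝ) (hq0 : 0 ≤ q) (hq1 : q < 1)
    (N : Ω → ℕ) (hNmeas : Measurable N)
    (hNgeom : ∀ n : ℕ, P {ω | n ≤ N ω} = ENNReal.ofReal (q ^ n))
    (hNindep : IndepFun (fun ω (i : ℕ) => X i ω) N P)
    (S : ℕ → Ω → ℝ) (hS : ∀ n ω, S n ω = RandomWalk.walk (fun i => X i ω) n)
    (L : Ω → ℕ) (hL : ∀ ω, L ω = RandomWalk.argMax (fun j => S j ω) (N ω))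
    (M : Ω → ℝ) (hM : ∀ ω, M ω = RandomWalk.pathMax (fun j => S j ω) (N ω))
    (pre : Ω → ℝ × ℝ) (hpre : ∀ ω, pre ω = ((L ω : ℝ), M ω))
    (post : Ω → ℝ × ℝ) (hpost : ∀ ω, post ω = ((N ω : ℝ) - (L ω : ℝ), S (N ω) ω - M ω)) :
    -- the maximum is almost surely attained at exactly one time, namely at time `L`
    (∀ᵐ ω ∂P, ∀ k : ℕ, (k ≤ N ω ∧ S k ω = M ω) ↔ k = L ω) ∧
    -- the two pairs are independent
    IndepFun pre post P ∧
    -- both are compound Poisson, with the stated jump intensities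
    RandomWalk.IsCompoundPoisson (P.map pre)
      (RandomWalk.faceIntensity P X q (Set.Ioi 0)) ∧
    RandomWalk.IsCompoundPoisson (P.map post)
      (RandomWalk.faceIntensity P X q (Set.Iic 0)) ∧
    -- the first pair is the sum over the faces with positive increment
    (∀ᵐ ω ∂P, pre ω =
      ∑ f ∈ RandomWalk.faces (fun j => S j ω) (N ω) with
          0 < RandomWalk.faceIncrement (fun j => S j ω) f,
        (RandomWalk.faceLength f, RandomWalk.faceIncrement (fun j => S j ω) f)) ∧
    -- the second pair is the sum over the remaining faces
    (∀ᵐ ω ∂P, post ω =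
      ∑ f ∈ RandomWalk.faces (fun j => S j ω) (N ω) with
          RandomWalk.faceIncrement (fun j => S j ω) f ≤ 0,
        (RandomWalk.faceLength f, RandomWalk.faceIncrement (fun j => S j ω) f)) := by
  obtain rfl : S = fun n ω => RandomWalk.walk (fun i => X i ω) n := by
    funext n ω
    exact hS n ω
  have hX : Measurable fun ω i => X i ω := measurable_pi_lambda _ hXmeas
  set μ := P.map (X 0)
  have : IsProbabilityMeasure μ := Measure.isProbabilityMeasure_map (hXmeas 0).aemeasurable
  have hXlaw : P.map (fun ω i => X i ω) = RandomWalk.iidLaw μ :=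
    RandomWalk.map_eq_iidLaw hXmeas hXindep hXident
  have hLm : Measurable L := by
    rw [funext hL]
    exact RandomWalk.measurable_argMax_walk hX hNmeas
  have hML : ∀ ω, M ω = RandomWalk.walk (fun i => X i ω) (L ω) := by
    intro ω
    rw [hM, hL]
    exact (RandomWalk.argMax_spec _ _).2.symm
  have hLN : ∀ ω, L ω ≤ N ω := fun ω => hL ω ▸ (RandomWalk.argMax_spec _ _).1
  have hMm : Measurable M := by
    rw [funext hML]
    exact RandomWalk.measurable_walk_random hX hLm
  have hprem : Measurable pre := by
    rw [funext hpre]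
    exact (measurable_from_top.comp hLm).prodMk hMm
  have hpostm : Measurable post := by
    rw [funext hpost]
    exact ((measurable_from_top.comp hNmeas).sub (measurable_from_top.comp hLm)).prodMk
      ((RandomWalk.measurable_walk_random hX hNmeas).sub hMm)
  have hinj := RandomWalk.ae_walk_injective_of_iIndepFun hXmeas hXindep hXident hXcont
  have huniq : ∀ᵐ ω ∂P, ∀ k ≤ N ω, k ≠ L ω →
      RandomWalk.walk (fun i => X i ω) k < RandomWalk.walk (fun i => X i ω) (L ω) := by
    filter_upwards [hinj] with ω hω k hk hne
    refine lt_of_le_of_ne ?_ fun h => hne (hω _ _ h)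
    rw [← hML, hM]
    exact RandomWalk.le_pathMax (s := fun j => RandomWalk.walk (fun i => X i ω) j) hk
  have hjoint : ∀ U V : Set (ℝ × ℝ), MeasurableSet U → MeasurableSet V →
      P (pre ⁻¹' U ∩ post ⁻¹' V) = ENNReal.ofReal (1 - q) *
        (RandomWalk.ladderMeasure μ q U * RandomWalk.belowMeasure μ q V) := by
    intro U V hU hV
    rw [← RandomWalk.measure_pre_inter_post μ hX hXlaw hNmeas hNindep hq0 hNgeom hL hU hV]
    congr 1
    ext ω
    simp only [Set.mem_inter_iff, Set.mem_preimage, Set.mem_ofPred_eq, hpre, hpost, hML]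
  -- Total mass one of the joint law. It ties together the normalising constants of the two
  -- marginals.
  have hone : ENNReal.ofReal (1 - q) * (RandomWalk.ladderMeasure μ q Set.univ *
      RandomWalk.belowMeasure μ q Set.univ) = 1 := by
    rw [← hjoint _ _ .univ .univ]
    simp
  have hprelaw : P.map pre = (ENNReal.ofReal (1 - q) * RandomWalk.belowMeasure μ q Set.univ) •
      RandomWalk.ladderMeasure μ q := by
    ext U hU
    have := hjoint U Set.univ hU .univ
    rw [Set.preimage_univ, Set.inter_univ] at this
    rw [Measure.map_apply hprem hU, this, Measure.smul_apply, smul_eq_mul]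
    ring
  have hpostlaw : P.map post = (ENNReal.ofReal (1 - q) * RandomWalk.ladderMeasure μ q Set.univ) •
      RandomWalk.belowMeasure μ q := by
    ext V hV
    have := hjoint Set.univ V .univ hV
    rw [Set.preimage_univ, Set.univ_inter] at this
    rw [Measure.map_apply hpostm hV, this, Measure.smul_apply, smul_eq_mul]
    ring
  refine ⟨?_, ?_, ?_, ?_, ?_, ?_⟩
  · filter_upwards [huniq] with ω hω k
    constructor
    · rintro ⟨hk, h⟩
      by_contra hne
      exact (hω k hk hne).ne (h.trans (hML ω))
    · rintro rfl
      exact ⟨hLN ω, (hML ω).symm⟩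
  · rw [indepFun_iff_measure_inter_preimage_eq_mul]
    intro U V hU hV
    rw [hjoint U V hU hV, ← Measure.map_apply hprem hU, ← Measure.map_apply hpostm hV, hprelaw,
      hpostlaw, Measure.smul_apply, Measure.smul_apply, smul_eq_mul, smul_eq_mul]
    -- The product of the marginals carries an extra factor, which is the total mass `1` from
    -- `hone`.
    calc _ = (ENNReal.ofReal (1 - q) * (RandomWalk.ladderMeasure μ q Set.univ *
          RandomWalk.belowMeasure μ q Set.univ)) * (ENNReal.ofReal (1 - q) *
          (RandomWalk.ladderMeasure μ q U * RandomWalk.belowMeasure μ q V)) := by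
          rw [hone, one_mul]
      _ = _ := by ring
  · rw [RandomWalk.faceIntensity_eq_jumpMeasure μ hX hXlaw]
    obtain ⟨_, _, h⟩ := RandomWalk.charFunDual_ladderMeasure μ hq0 hq1
    exact RandomWalk.isCompoundPoisson_of_map_eq_smul hprem hprelaw h
  · rw [RandomWalk.faceIntensity_eq_jumpMeasure μ hX hXlaw]
    obtain ⟨_, _, h⟩ := RandomWalk.charFunDual_belowMeasure μ hq0 hq1
    exact RandomWalk.isCompoundPoisson_of_map_eq_smul hpostm hpostlaw h
  · filter_upwards [huniq] with ω hω
    rw [hL] at hω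
    rw [RandomWalk.sum_faceIncrement_pos hω, hpre, hML, hL]
    simp only [RandomWalk.walk_zero, sub_zero]
  · filter_upwards [huniq] with ω hω
    rw [hL] at hω
    rw [RandomWalk.sum_faceIncrement_nonpos hω, hpost, hML, hL]
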